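/- For integers $n,m\ge 1$ and $p\in(0,1)$ let $\mathcal G(n,m,p)$ be the random intersection graph: each of $n$ vertices $v$ gets a random subset $\mathcal W(v)$ of a set $\mathcal W$ of $m$ features, where $w\in\mathcal W(v)$ with probability $p$ independently for all pairs $(v,w)$, and two distinct vertices $v,v'$ are adjacent if and only if $\mathcal W(v)\cap\mathcal W(v')\neq\emptyset$. Let $\delta$ denote the minimum degree. Let $m=m(n)$, $p=p(n)\in(0,1)$, let $(a_n)$ and $(c_n)$ be real sequences and let $\varepsilon>0$ be a constant, and let all limits be taken as $n\to\infty$. Assume that $\ln^2 n=o(m)$, that $c_n=o(\ln n)$, and that for all large $n$ $$p\bigl(1-(1-p)^{n-1}\bigr)=\frac{\ln n+\ln a_n+c_n}{m},$$ where for every large $n$ either $m<(1-\varepsilon)\frac{n\ln n}{\ln\ln n}$ and $a_n=1$, or $m>(1+\varepsilon)\frac{n\ln n}{\ln\ln n}$ and $a_n=\frac{np\ln n}{e^{np}-1}$. Then $$\lim_{n\to\infty}\Pr\{\delta(\mathcal G(n,m,p))\ge 2\}=\begin{cases}0&\text{if } c_n\to-\infty,\\ e^{-e^{-c}}&\text{if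 } c_n\to c\in(-\infty,\infty),\\ 1&\text{if } c_n\to\infty.\end{cases}$$ -/

import Mathlib

open Filter Topology Asymptotics MeasureTheory ProbabilityTheory

/-- A choice of features: `ω (v, w) = true` means that vertex `v` (among `n`) chose
feature `w` (among `m`), i.e. `w ∈ W(v)`. -/
abbrev FeatureChoice (n m : ℕ) : Type := Fin n × Fin m → Bool

/-- The intersection graph of a choice of features: two distinct vertices are joined by an
edge if and only if some feature was chosen by both of them. -/
def intersectionGraph {n m : ℕ} (ω : FeatureChoice n m) : SimpleGraph (Fin n) where
  Adj v v' := v ≠ v' ∧ ∃ w : Fin m, ω (v, w) = true ∧ ω (v', w) = true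
  symm := ⟨fun _ _ h => ⟨h.1.symm, h.2.imp fun _ hw => hw.symm⟩⟩
  loopless := ⟨fun _ h => h.1 rfl⟩

instance {n m : ℕ} (ω : FeatureChoice n m) : DecidableRel (intersectionGraph ω).Adj :=
  fun v v' => inferInstanceAs
    (Decidable (v ≠ v' ∧ ∃ w : Fin m, ω (v, w) = true ∧ ω (v', w) = true))

/-- The law of the features in `G(n, m, p)`: every vertex chooses every feature with
probability `p`, all the choices being independent. -/
noncomputable def featureMeasure (n m : ℕ) (p : unitInterval) : Measure (FeatureChoice n m) :=
  Measure.pi fun _ => bernoulliMeasure true false p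

/-- The probability that the random intersection graph `G(n, m, p)` has minimum degree at
least `2`. -/
noncomputable def probMinDegreeGeTwo (n m : ℕ) (p : unitInterval) : ℝ :=
  (featureMeasure n m p).real {ω | 2 ≤ (intersectionGraph ω).minDegree}

/-- The set of vertices that chose the feature `w`. -/
def featureUsers {n m : ℕ} (ω : FeatureChoice n m) (w : Fin m) : Finset (Fin n) :=
  Finset.univ.filter fun v => ω (v, w) = true

/-- The probability that a given feature is chosen exactly by the vertices of `U`. -/
noncomputable def usersWeight {n : ℕ} (p : ℝ) (U : Finset (Fin n)) : ℝ :=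
  p ^ U.card * (1 - p) ^ (n - U.card)

/-- A choice of features is the same as a family of sets of users. -/
def featureUsersEquiv (n m : ℕ) : FeatureChoice n m ≃ (Fin m → Finset (Fin n)) where
  toFun ω := featureUsers ω
  invFun X := fun x => decide (x.1 ∈ X x.2)
  left_inv ω := by ext ⟨v, w⟩; simp [featureUsers]
  right_inv X := by ext w v; simp [featureUsers]

lemma mem_featureUsers {n m : ℕ} (ω : FeatureChoice n m) (w : Fin m) (v : Fin n) :
    v ∈ featureUsers ω w ↔ ω (v, w) = true := by simp [featureUsers]

instance {n m : ℕ} (p : unitInterval) : IsProbabilityMeasure (featureMeasure n m p) := by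
  unfold featureMeasure; infer_instance

lemma featureMeasure_real_singleton {n m : ℕ} (p : unitInterval) (ω : FeatureChoice n m) :
    (featureMeasure n m p).real {ω} = ∏ x, if ω x = true then (p : ℝ) else 1 - p := by
  rw [measureReal_def, featureMeasure, Measure.pi_singleton, ENNReal.toReal_prod]
  refine Finset.prod_congr rfl fun x _ => ?_
  change (bernoulliMeasure true false p).real {ω x} = _
  rw [bernoulliMeasure_real_apply _ (measurableSet_singleton _)]
  cases ω x <;> simp

lemma featureMeasure_real_singleton_eq_prod_usersWeight {n m : ℕ} (p : unitInterval)
    (ω : FeatureChoice n m) :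
    (featureMeasure n m p).real {ω} = ∏ w, usersWeight (p : ℝ) (featureUsers ω w) := by
  rw [featureMeasure_real_singleton, Fintype.prod_prod_type_right]
  refine Finset.prod_congr rfl fun w _ => ?_
  rw [Finset.prod_ite, Finset.prod_const, Finset.prod_const, usersWeight, featureUsers]
  congr 2
  rw [← Finset.compl_filter, Finset.card_compl, Fintype.card_fin]

lemma featureMeasure_real_eq_sum {n m : ℕ} (p : unitInterval) (A : Set (FeatureChoice n m))
    [DecidablePred (· ∈ A)] :
    (featureMeasure n m p).real A
      = ∑ ω, (featureMeasure n m p).real {ω} * (if ω ∈ A then 1 else 0) := by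
  have : A = ((Finset.univ.filter (· ∈ A) : Finset (FeatureChoice n m)) : Set _) := by
    ext; simp
  conv_lhs => rw [this]
  rw [← sum_measureReal_singleton, Finset.sum_filter]
  simp

/-- The sets of users of different features are independent. -/
lemma featureMeasure_real_forall_users_mem {n m : ℕ} (p : unitInterval)
    (T : Fin m → Finset (Finset (Fin n))) :
    (featureMeasure n m p).real {ω | ∀ w, featureUsers ω w ∈ T w}
      = ∏ w, ∑ U ∈ T w, usersWeight (p : ℝ) U := by
  classical
  rw [Finset.prod_univ_sum, featureMeasure_real_eq_sum]
  simp_rw [featureMeasure_real_singleton_eq_prod_usersWeight]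
  rw [Fintype.sum_equiv (featureUsersEquiv n m) _ (fun X : Fin m → Finset (Fin n) =>
    (∏ w, usersWeight (p : ℝ) (X w)) * (if X ∈ Fintype.piFinset T then 1 else 0))]
  · simp_rw [mul_ite, mul_one, mul_zero]
    rw [← Finset.sum_filter]
    congr 1
    ext; simp
  · intro ω
    simp [featureUsersEquiv, Fintype.mem_piFinset]

lemma usersWeight_nonneg {n : ℕ} (p : unitInterval) (U : Finset (Fin n)) :
    0 ≤ usersWeight (p : ℝ) U :=
  mul_nonneg (pow_nonneg p.2.1 _) (pow_nonneg (by linarith [p.2.2]) _)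

lemma usersWeight_singleton {n : ℕ} (p : ℝ) (v : Fin n) :
    usersWeight p {v} = p * (1 - p) ^ (n - 1) := by simp [usersWeight]

lemma usersWeight_pair {n : ℕ} (p : ℝ) {v u : Fin n} (h : v ≠ u) :
    usersWeight p {v, u} = p ^ 2 * (1 - p) ^ (n - 2) := by
  simp [usersWeight, Finset.card_pair h]

lemma sum_usersWeight_powerset_compl {n : ℕ} (p : ℝ) (S : Finset (Fin n)) :
    ∑ U ∈ Sᶜ.powerset, usersWeight p U = (1 - p) ^ S.card := by
  have hS : S.card ≤ n := by simpa using S.card_le_univ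
  have h : ∀ U ∈ Sᶜ.powerset, usersWeight p U
      = (1 - p) ^ S.card * (p ^ U.card * (1 - p) ^ (Sᶜ.card - U.card)) := by
    intro U hU
    have hU' : U.card ≤ Sᶜ.card := Finset.card_le_card (Finset.mem_powerset.1 hU)
    rw [Finset.card_compl, Fintype.card_fin] at hU' ⊢
    rw [usersWeight, mul_left_comm, ← pow_add]
    congr 2
    omega
  rw [Finset.sum_congr rfl h, ← Finset.mul_sum, Finset.sum_pow_mul_eq_add_pow]
  simp

/-- Every neighbour of `v` is the same vertex, i.e. `v` has degree at most one. -/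
def HasAtMostOneNeighbor {n m : ℕ} (ω : FeatureChoice n m) (v : Fin n) : Prop :=
  ∀ u u', (intersectionGraph ω).Adj v u → (intersectionGraph ω).Adj v u' → u = u'

lemma two_le_minDegree_iff {n m : ℕ} [NeZero n] (ω : FeatureChoice n m) :
    2 ≤ (intersectionGraph ω).minDegree ↔ ∀ v, ¬ HasAtMostOneNeighbor ω v := by
  have key : ∀ v, ¬ HasAtMostOneNeighbor ω v ↔ 2 ≤ (intersectionGraph ω).degree v := by
    intro v
    rw [← SimpleGraph.card_neighborFinset_eq_degree, Nat.succ_le_iff, ← not_le,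
      Finset.card_le_one, not_iff_not]
    simp only [SimpleGraph.mem_neighborFinset, HasAtMostOneNeighbor]
    tauto
  simp_rw [key]
  exact ⟨fun h v => h.trans (SimpleGraph.minDegree_le_degree _ v),
    fun h => SimpleGraph.le_minDegree_of_forall_le_degree _ _ h⟩

lemma intersectionGraph_adj_iff {n m : ℕ} (ω : FeatureChoice n m) (v u : Fin n) :
    (intersectionGraph ω).Adj v u ↔
      v ≠ u ∧ ∃ w, v ∈ featureUsers ω w ∧ u ∈ featureUsers ω w := by
  simp only [mem_featureUsers]
  rfl

lemma HasAtMostOneNeighbor.antitone {n m : ℕ} {ω ω' : FeatureChoice n m} (h : ω ≤ ω')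
    {v : Fin n} (hv : HasAtMostOneNeighbor ω' v) : HasAtMostOneNeighbor ω v := by
  have hmono : ∀ u, (intersectionGraph ω).Adj v u → (intersectionGraph ω').Adj v u := by
    rintro u ⟨hne, w, h1, h2⟩
    exact ⟨hne, w, h _ h1, h _ h2⟩
  exact fun u u' hu hu' => hv u u' (hmono u hu) (hmono u' hu')

/-- Decreasing events are positively correlated. -/
lemma featureMeasure_real_mul_le_inter {n m : ℕ} (p : unitInterval)
    {A B : Set (FeatureChoice n m)} (hA : IsLowerSet A) (hB : IsLowerSet B) :
    (featureMeasure n m p).real A * (featureMeasure n m p).real B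
      ≤ (featureMeasure n m p).real (A ∩ B) := by
  classical
  have hcompl : ∀ A B : Set (FeatureChoice n m), IsUpperSet A → IsUpperSet B →
      (featureMeasure n m p).real A * (featureMeasure n m p).real B
        ≤ (featureMeasure n m p).real (A ∩ B) := by
    intro A B hA hB
    have hmono : ∀ A : Set (FeatureChoice n m), IsUpperSet A →
        Monotone (fun ω => if ω ∈ A then (1 : ℝ) else 0) := by
      intro A hA ω ω' h
      by_cases h1 : ω ∈ A
      · simp [h1, hA h h1]
      · simp only [h1, if_false]
        split_ifs <;> norm_num
    have h := fkg (μ := fun ω : FeatureChoice n m => (featureMeasure n m p).real {ω})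
      (f := fun ω => if ω ∈ A then (1 : ℝ) else 0) (g := fun ω => if ω ∈ B then (1 : ℝ) else 0)
      (fun ω => measureReal_nonneg) (fun ω => by dsimp; split_ifs <;> norm_num)
      (fun ω => by dsimp; split_ifs <;> norm_num) (hmono A hA) (hmono B hB)
      (fun a b => by
        simp only [featureMeasure_real_singleton, ← Finset.prod_mul_distrib]
        refine le_of_eq (Finset.prod_congr rfl fun x _ => ?_)
        rw [Pi.inf_apply, Pi.sup_apply]
        cases a x <;> cases b x <;> simp [mul_comm])
    have htot : ∑ ω, (featureMeasure n m p).real {ω} = 1 := by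
      rw [sum_measureReal_singleton]; simp
    rw [← featureMeasure_real_eq_sum, ← featureMeasure_real_eq_sum, htot, one_mul] at h
    refine h.trans (le_of_eq ?_)
    rw [featureMeasure_real_eq_sum]
    refine Finset.sum_congr rfl fun ω _ => ?_
    by_cases h1 : ω ∈ A <;> by_cases h2 : ω ∈ B <;> simp [h1, h2]
  have h := hcompl Aᶜ Bᶜ hA.compl hB.compl
  have hAB : (featureMeasure n m p).real (Aᶜ ∩ Bᶜ)
      = 1 - (featureMeasure n m p).real (A ∪ B) := by
    rw [← Set.compl_union, probReal_compl_eq_one_sub (Set.toFinite _).measurableSet]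
  rw [hAB, probReal_compl_eq_one_sub (Set.toFinite _).measurableSet,
    probReal_compl_eq_one_sub (Set.toFinite _).measurableSet] at h
  have hU := measureReal_union_add_inter (μ := featureMeasure n m p) (s := A) (t := B)
    (Set.toFinite _).measurableSet
  nlinarith

lemma prod_le_featureMeasure_real_forall {n m : ℕ} (p : unitInterval) (S : Finset (Fin n)) :
    ∏ v ∈ S, (featureMeasure n m p).real {ω | HasAtMostOneNeighbor ω v}
      ≤ (featureMeasure n m p).real {ω | ∀ v ∈ S, HasAtMostOneNeighbor ω v} := by
  classical
  induction S using Finset.induction_on with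
  | empty => simp
  | insert v S hv ih =>
    rw [Finset.prod_insert hv]
    refine (mul_le_mul_of_nonneg_left ih measureReal_nonneg).trans ?_
    refine (featureMeasure_real_mul_le_inter p ?_ ?_).trans (le_of_eq ?_)
    · exact fun ω ω' h hω => hω.antitone h
    · exact fun ω ω' h hω u hu => (hω u hu).antitone h
    · congr 1
      ext ω
      simp

lemma mem_powerset_compl_singleton {n : ℕ} {v : Fin n} {U : Finset (Fin n)} :
    U ∈ ({v}ᶜ : Finset (Fin n)).powerset ↔ v ∉ U := by
  rw [Finset.mem_powerset, Finset.subset_compl_comm, Finset.singleton_subset_iff,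
    Finset.mem_compl]

/-- `v` has no neighbour outside `{u}` iff each feature of `v` is chosen by `v` alone or by
exactly `v` and `u`. -/
lemma forall_adj_eq_iff {n m : ℕ} (ω : FeatureChoice n m) {v u : Fin n} :
    (∀ x, (intersectionGraph ω).Adj v x → x = u) ↔
      ∀ w, featureUsers ω w ∈ ({v}ᶜ : Finset (Fin n)).powerset ∪ {{v}, {v, u}} := by
  simp only [intersectionGraph_adj_iff, Finset.mem_union, 
    mem_powerset_compl_singleton, Finset.mem_insert, Finset.mem_singleton]
  constructor
  · intro h w
    by_cases hv : v ∈ featureUsers ω w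
    · right
      have hsub : ∀ x ∈ featureUsers ω w, x = v ∨ x = u := fun x hx => by
        by_cases hx' : x = v
        · exact Or.inl hx'
        · exact Or.inr (h x ⟨fun e => hx' e.symm, w, hv, hx⟩)
      by_cases hu : u ∈ featureUsers ω w
      · right
        ext x
        simp only [Finset.mem_insert, Finset.mem_singleton]
        exact ⟨hsub x, by rintro (rfl | rfl) <;> assumption⟩
      · left
        ext x
        simp only [Finset.mem_singleton]
        refine ⟨fun hx => ?_, by rintro rfl; exact hv⟩
        rcases hsub x hx with rfl | rfl
        · rfl
        · exact absurd hx hu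
    · exact Or.inl hv
  · rintro h x ⟨hvx, w, hv, hx⟩
    rcases h w with h | h | h
    · exact absurd hv h
    · rw [h, Finset.mem_singleton] at hx; exact absurd hx.symm hvx
    · rw [h, Finset.mem_insert, Finset.mem_singleton] at hx
      exact hx.resolve_left fun e => hvx e.symm

lemma featureMeasure_real_forall_adj_eq {n m : ℕ} (p : unitInterval) {v u : Fin n} (h : v ≠ u) :
    (featureMeasure n m p).real {ω | ∀ x, (intersectionGraph ω).Adj v x → x = u}
      = (1 - (p : ℝ) * (1 - (1 - p) ^ (n - 1)) + (p : ℝ) ^ 2 * (1 - p) ^ (n - 2)) ^ m := by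
  simp_rw [forall_adj_eq_iff]
  rw [featureMeasure_real_forall_users_mem]
  have hne : ({v} : Finset (Fin n)) ≠ {v, u} := fun e => by
    have : u ∈ ({v} : Finset (Fin n)) := by rw [e]; simp
    exact h (Finset.mem_singleton.1 this).symm
  rw [Finset.sum_union, sum_usersWeight_powerset_compl, Finset.sum_pair hne,
    usersWeight_singleton, usersWeight_pair _ h, Finset.prod_const]
  · simp only [Finset.card_univ, Fintype.card_fin, Finset.card_singleton, pow_one]
    ring
  · rw [Finset.disjoint_left]
    simp only [mem_powerset_compl_singleton, Finset.mem_insert,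
      Finset.mem_singleton]
    rintro U hU (rfl | rfl) <;> simp at hU

lemma featureMeasure_real_isolated {n m : ℕ} (p : unitInterval) (v : Fin n) :
    (featureMeasure n m p).real {ω | ∀ x, ¬ (intersectionGraph ω).Adj v x}
      = (1 - (p : ℝ) * (1 - (1 - p) ^ (n - 1))) ^ m := by
  have hset : {ω : FeatureChoice n m | ∀ x, ¬ (intersectionGraph ω).Adj v x}
      = {ω | ∀ w, featureUsers ω w ∈ ({v}ᶜ : Finset (Fin n)).powerset ∪ {{v}}} := by
    ext ω
    have h := forall_adj_eq_iff ω (v := v) (u := v)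
    rw [Finset.pair_eq_singleton, Finset.pair_eq_singleton] at h
    rw [Set.mem_ofPred_eq, Set.mem_ofPred_eq, ← h]
    refine forall_congr' fun x => ⟨fun h1 h2 => absurd h2 h1, fun h1 h2 => ?_⟩
    exact h2.ne (h1 h2).symm
  rw [hset, featureMeasure_real_forall_users_mem, Finset.sum_union,
    sum_usersWeight_powerset_compl, Finset.sum_singleton, usersWeight_singleton, Finset.prod_const]
  · simp only [Finset.card_univ, Fintype.card_fin, Finset.card_singleton, pow_one]
    ring
  · rw [Finset.disjoint_left]
    simp only [mem_powerset_compl_singleton, Finset.mem_singleton]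
    rintro U hU rfl; simp at hU

lemma add_pow_sub_pow_ge {x y : ℝ} (hx : 0 ≤ x) (hx1 : x ≤ 1) (hy : 0 ≤ y) (m : ℕ) :
    x ^ m * (m * y) ≤ (x + y) ^ m - x ^ m := by
  induction m with
  | zero => simp
  | succ m ih =>
    have h1 : (x + y) ^ m ≥ x ^ m := pow_le_pow_left₀ hx (by linarith) m
    have h2 : x ^ m * x ≤ x ^ m * 1 := mul_le_mul_of_nonneg_left hx1 (pow_nonneg hx m)
    have h3 := mul_le_mul_of_nonneg_right ih hx
    have h4 := mul_le_mul_of_nonneg_right h1 hy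
    have h5 := mul_le_mul_of_nonneg_right h2 hy
    rw [pow_succ, pow_succ]
    push_cast
    nlinarith

lemma le_featureMeasure_real_hasAtMostOneNeighbor {n m : ℕ} (p : unitInterval) (v : Fin n) :
    (1 - (p : ℝ) * (1 - (1 - p) ^ (n - 1))) ^ m
        * (1 + (n - 1 : ℝ) * (m * ((p : ℝ) ^ 2 * (1 - p) ^ (n - 2))))
      ≤ (featureMeasure n m p).real {ω | HasAtMostOneNeighbor ω v} := by
  classical
  have hp0 : 0 ≤ (p : ℝ) := p.2.1
  have hp1 : (p : ℝ) ≤ 1 := p.2.2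
  set q := (p : ℝ) * (1 - (1 - p) ^ (n - 1)) with hq
  set s := (p : ℝ) ^ 2 * (1 - p) ^ (n - 2) with hs
  have hs0 : 0 ≤ s := mul_nonneg (sq_nonneg _) (pow_nonneg (by linarith) _)
  have hr0 : 0 ≤ (1 - (p : ℝ)) ^ (n - 1) := pow_nonneg (by linarith) _
  have hr1 : (1 - (p : ℝ)) ^ (n - 1) ≤ 1 := pow_le_one₀ (by linarith) (by linarith)
  have hq0 : 0 ≤ q := mul_nonneg hp0 (by linarith)
  have hq1 : q ≤ 1 := mul_le_one₀ hp1 (by linarith) (by linarith)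
  let I : Set (FeatureChoice n m) := {ω | ∀ x, ¬ (intersectionGraph ω).Adj v x}
  let J : Fin n → Set (FeatureChoice n m) := fun u =>
    {ω | ∀ x, (intersectionGraph ω).Adj v x ↔ x = u}
  have hms : ∀ A : Set (FeatureChoice n m), MeasurableSet A := fun A =>
    (Set.toFinite A).measurableSet
  have hJ : ∀ u ∈ Finset.univ.erase v, (1 - q) ^ m * (m * s) ≤ (featureMeasure n m p).real (J u) := by
    intro u hu
    have hvu : v ≠ u := (Finset.ne_of_mem_erase hu).symm
    have hJu : J u = {ω | ∀ x, (intersectionGraph ω).Adj v x → x = u} \ I := by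
      ext ω
      simp only [J, I, Set.mem_ofPred_eq, Set.mem_sdiff]
      constructor
      · exact fun h => ⟨fun x => (h x).1, fun h' => h' u ((h u).2 rfl)⟩
      · rintro ⟨h1, h2⟩ x
        push Not at h2
        obtain ⟨y, hy⟩ := h2
        refine ⟨h1 x, ?_⟩
        rintro rfl
        rwa [h1 y hy] at hy
    have hI : I ⊆ {ω | ∀ x, (intersectionGraph ω).Adj v x → x = u} :=
      fun ω hω x hx => absurd hx (hω x)
    rw [hJu, measureReal_sdiff hI (hms _),
      featureMeasure_real_forall_adj_eq p hvu, featureMeasure_real_isolated, ← hq, ← hs]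
    exact add_pow_sub_pow_ge (by linarith) (by linarith) hs0 m
  have hdisj : (Finset.univ.erase v : Set (Fin n)).PairwiseDisjoint J := by
    intro u _ u' _ huu
    rw [Function.onFun, Set.disjoint_left]
    intro ω h1 h2
    exact huu ((h2 u).1 ((h1 u).2 rfl))
  have hU : (featureMeasure n m p).real (⋃ u ∈ Finset.univ.erase v, J u)
      = ∑ u ∈ Finset.univ.erase v, (featureMeasure n m p).real (J u) :=
    measureReal_biUnion_finset (by simpa using hdisj) fun _ _ => hms _
  have hIU : (featureMeasure n m p).real (I ∪ ⋃ u ∈ Finset.univ.erase v, J u)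
      = (featureMeasure n m p).real I + (featureMeasure n m p).real (⋃ u ∈ Finset.univ.erase v, J u) := by
    refine measureReal_union ?_ (hms _) (measure_ne_top _ _) (measure_ne_top _ _)
    rw [Set.disjoint_left]
    intro ω hI hω
    simp only [Set.mem_iUnion] at hω
    obtain ⟨u, _, hu⟩ := hω
    exact hI u ((hu u).2 rfl)
  have hsub : I ∪ ⋃ u ∈ Finset.univ.erase v, J u ⊆ {ω | HasAtMostOneNeighbor ω v} := by
    rintro ω (hI | hω)
    · exact fun u _ hu _ => absurd hu (hI u)
    · simp only [Set.mem_iUnion] at hω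
      obtain ⟨u, _, hu⟩ := hω
      exact fun x y hx hy => ((hu x).1 hx).trans ((hu y).1 hy).symm
  refine le_trans ?_ (measureReal_mono hsub)
  rw [hIU, hU, featureMeasure_real_isolated, ← hq]
  have hsum := Finset.sum_le_sum hJ
  rw [Finset.sum_const, Finset.card_erase_of_mem (Finset.mem_univ v), Finset.card_univ,
    Fintype.card_fin, nsmul_eq_mul, Nat.cast_sub (by have := v.2; omega), Nat.cast_one] at hsum
  linarith

/-- The event that, for every `v ∈ S` with `F v = some (u, w)`, the users of `w` are exactly `v`
and `u`, and that a feature chosen in `S` is chosen by one vertex only, or by `v` and `u` only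
for some `v ∈ S` with `F v = some (u, _)`. The edges `F` are directed upwards inside `S`. -/
def pendantPattern {n m : ℕ} (S : Finset (Fin n)) (F : S → Option (Fin n × Fin m)) :
    Set (FeatureChoice n m) :=
  {ω | (∀ v u w, F v = some (u, w) →
      v.1 ≠ u ∧ (u ∈ S → v.1 < u) ∧ featureUsers ω w = {v.1, u}) ∧
    ∀ w, featureUsers ω w ∈ Sᶜ.powerset ∨ (∃ v ∈ S, featureUsers ω w = {v}) ∨
      ∃ v u w', F v = some (u, w') ∧ v.1 ≠ u ∧ featureUsers ω w = {v.1, u}}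

lemma HasAtMostOneNeighbor.featureUsers_eq_pair {n m : ℕ} {ω : FeatureChoice n m} {v u : Fin n}
    (h : HasAtMostOneNeighbor ω v) {w : Fin m} (hvu : v ≠ u) (hv : v ∈ featureUsers ω w)
    (hu : u ∈ featureUsers ω w) : featureUsers ω w = {v, u} := by
  ext x
  simp only [Finset.mem_insert, Finset.mem_singleton]
  refine ⟨fun hx => ?_, by rintro (rfl | rfl) <;> assumption⟩
  by_cases hxv : x = v
  · exact Or.inl hxv
  · refine Or.inr (h x u ?_ ?_) <;> rw [intersectionGraph_adj_iff]
    · exact ⟨fun e => hxv e.symm, w, hv, hx⟩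
    · exact ⟨hvu, w, hv, hu⟩

lemma forall_hasAtMostOneNeighbor_subset_iUnion {n m : ℕ} (S : Finset (Fin n)) :
    {ω : FeatureChoice n m | ∀ v ∈ S, HasAtMostOneNeighbor ω v} ⊆ ⋃ F, pendantPattern S F := by
  classical
  intro ω hω
  rw [Set.mem_iUnion]
  let Q : S → Fin n × Fin m → Prop := fun v x =>
    v.1 ≠ x.1 ∧ (x.1 ∈ S → v.1 < x.1) ∧ v.1 ∈ featureUsers ω x.2 ∧ x.1 ∈ featureUsers ω x.2
  let F : S → Option (Fin n × Fin m) := fun v =>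
    if h : ∃ x, Q v x then some h.choose else none
  have hF : ∀ v x, F v = some x → Q v x := by
    intro v x hx
    by_cases h : ∃ x, Q v x
    · simp only [F, h, dif_pos, Option.some.injEq] at hx
      rw [← hx]
      exact h.choose_spec
    · exact absurd (hx.symm.trans (dif_neg h)) (Option.some_ne_none x)
  have hF' : ∀ v x, Q v x → ∃ y, F v = some y ∧ y.1 = x.1 := by
    intro v x hx
    have h : ∃ x, Q v x := ⟨x, hx⟩
    refine ⟨h.choose, by simp only [F, h, dif_pos], ?_⟩
    have h2 := h.choose_spec
    apply hω v.1 v.2 <;> rw [intersectionGraph_adj_iff]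
    · exact ⟨h2.1, _, h2.2.2.1, h2.2.2.2⟩
    · exact ⟨hx.1, _, hx.2.2.1, hx.2.2.2⟩
  refine ⟨F, fun v u w h => ?_, fun w => ?_⟩
  · obtain ⟨h1, h2, h3, h4⟩ := hF v _ h
    exact ⟨h1, h2, (hω v.1 v.2).featureUsers_eq_pair h1 h3 h4⟩
  · by_cases hS : featureUsers ω w ∈ Sᶜ.powerset
    · exact Or.inl hS
    right
    have hS' : ∃ v ∈ S, v ∈ featureUsers ω w := by
      by_contra! h
      exact hS (Finset.mem_powerset.2 fun x hx =>
        Finset.mem_compl.2 fun hxS => h x hxS hx)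
    obtain ⟨v, hvS, hvw⟩ := hS'
    by_cases h1 : featureUsers ω w = {v}
    · exact Or.inl ⟨v, hvS, h1⟩
    right
    have h2 : ∃ u ∈ featureUsers ω w, u ≠ v := by
      by_contra! h
      exact h1 (Finset.eq_singleton_iff_unique_mem.2 ⟨hvw, h⟩)
    obtain ⟨u, huw, huv⟩ := h2
    have hpair := (hω v hvS).featureUsers_eq_pair huv.symm hvw huw
    by_cases h3 : u ∈ S → v < u
    · obtain ⟨y, hy, hyu⟩ := hF' ⟨v, hvS⟩ (u, w) ⟨huv.symm, h3, hvw, huw⟩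
      exact ⟨⟨v, hvS⟩, u, y.2, hy.trans (congrArg some (Prod.ext hyu rfl)), huv.symm, hpair⟩
    · push Not at h3
      obtain ⟨huS, hvu⟩ := h3
      obtain ⟨y, hy, hyv⟩ := hF' ⟨u, huS⟩ (v, w) ⟨huv, fun _ => lt_of_le_of_ne hvu huv, huw, hvw⟩
      exact ⟨⟨u, huS⟩, v, y.2, hy.trans (congrArg some (Prod.ext hyv rfl)), huv, by rw [hpair, Finset.pair_comm]⟩

lemma Finset.sum_union_le_add {α : Type*} [DecidableEq α] {f : α → ℝ} (hf : ∀ a, 0 ≤ f a)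
    (A B : Finset α) : ∑ a ∈ A ∪ B, f a ≤ ∑ a ∈ A, f a + ∑ a ∈ B, f a := by
  rw [← Finset.sum_union_inter]
  exact le_add_of_nonneg_right (Finset.sum_nonneg fun a _ => hf a)

lemma sum_usersWeight_le {n m : ℕ} (p : unitInterval) (S : Finset (Fin n))
    (F : S → Option (Fin n × Fin m)) :
    ∑ U ∈ Sᶜ.powerset ∪ (S.image (fun v => ({v} : Finset (Fin n))) ∪
        Finset.univ.filter fun U : Finset (Fin n) =>
          ∃ v u w', F v = some (u, w') ∧ v.1 ≠ u ∧ U = {v.1, u}), usersWeight (p : ℝ) U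
      ≤ (1 - (p : ℝ)) ^ S.card + S.card * ((p : ℝ) * (1 - p) ^ (n - 1))
          + S.card * ((p : ℝ) ^ 2 * (1 - p) ^ (n - 2)) := by
  classical
  refine (Finset.sum_union_le_add (usersWeight_nonneg p) _ _).trans ?_
  rw [sum_usersWeight_powerset_compl, add_assoc]
  refine add_le_add le_rfl ((Finset.sum_union_le_add (usersWeight_nonneg p) _ _).trans
    (add_le_add ?_ ?_))
  · rw [Finset.sum_image fun a _ b _ h => Finset.singleton_injective h]
    simp [usersWeight_singleton]
  · have hs0 : 0 ≤ (p : ℝ) ^ 2 * (1 - p) ^ (n - 2) :=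
      mul_nonneg (sq_nonneg _) (pow_nonneg (by linarith [p.2.2]) _)
    refine (Finset.sum_le_card_nsmul _ _ ((p : ℝ) ^ 2 * (1 - p) ^ (n - 2)) ?_).trans ?_
    · intro U hU
      obtain ⟨v, u, w', _, hvu, rfl⟩ := (Finset.mem_filter.1 hU).2
      rw [usersWeight_pair _ hvu]
    · rw [nsmul_eq_mul]
      refine mul_le_mul_of_nonneg_right (Nat.cast_le.2 ?_) hs0
      let g : S → Finset (Fin n) := fun v => insert v.1 ((F v).elim ∅ fun x => {x.1})
      have hsub : (Finset.univ.filter fun U : Finset (Fin n) =>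
          ∃ v u w', F v = some (u, w') ∧ v.1 ≠ u ∧ U = {v.1, u}) ⊆ Finset.univ.image g := by
        intro U hU
        obtain ⟨v, u, w', h, hvu, rfl⟩ := (Finset.mem_filter.1 hU).2
        exact Finset.mem_image.2 ⟨v, Finset.mem_univ v, by simp [g, h]⟩
      exact (Finset.card_le_card hsub).trans (Finset.card_image_le.trans (by simp))

lemma featureMeasure_real_pendantPattern_le {n m : ℕ} (p : unitInterval) (S : Finset (Fin n))
    (F : S → Option (Fin n × Fin m)) {s ρ : ℝ} (hs : s = (p : ℝ) ^ 2 * (1 - p) ^ (n - 2))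
    (hρ : ρ = (1 - (p : ℝ)) ^ S.card + S.card * ((p : ℝ) * (1 - p) ^ (n - 1)) + S.card * s)
    (hρ0 : 0 < ρ) :
    (featureMeasure n m p).real (pendantPattern S F)
      ≤ ρ ^ m * ∏ v, (F v).elim 1 fun _ => s / ρ := by
  classical
  have hs0 : 0 ≤ s := by
    rw [hs]; exact mul_nonneg (sq_nonneg _) (pow_nonneg (by linarith [p.2.2]) _)
  have hsρ : 0 ≤ s / ρ := div_nonneg hs0 hρ0.le
  by_cases hne : (pendantPattern S F).Nonempty
  swap
  · rw [Set.not_nonempty_iff_eq_empty.1 hne, measureReal_empty]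
    refine mul_nonneg (pow_nonneg hρ0.le _) (Finset.prod_nonneg fun v _ => ?_)
    cases F v <;> simp [hsρ]
  obtain ⟨ω₀, hω₀⟩ := hne
  let D : Finset S := Finset.univ.filter fun v => (F v).isSome
  let I : Finset (Fin m) := Finset.univ.filter fun w => ∃ v u, F v = some (u, w)
  have hcard : I.card = D.card := by
    symm
    refine Finset.card_bij (fun v hv => ((F v).get (Finset.mem_filter.1 hv).2).2) ?_ ?_ ?_
    · intro v hv
      refine Finset.mem_filter.2 ⟨Finset.mem_univ _, v,
        ((F v).get (Finset.mem_filter.1 hv).2).1, ?_⟩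
      simp
    · intro v hv v' hv' h
      obtain ⟨⟨u, w⟩, hx⟩ := Option.isSome_iff_exists.1 (Finset.mem_filter.1 hv).2
      obtain ⟨⟨u', w'⟩, hx'⟩ := Option.isSome_iff_exists.1 (Finset.mem_filter.1 hv').2
      simp only [hx, hx', Option.get_some] at h
      subst h
      obtain ⟨h1, h2, h3⟩ := hω₀.1 v u w hx
      obtain ⟨h1', h2', h3'⟩ := hω₀.1 v' u' w hx'
      rw [h3] at h3'
      by_contra hvv
      have hvv' : v.1 ≠ v'.1 := fun e => hvv (Subtype.ext e)
      have e1 : v.1 ∈ ({v'.1, u'} : Finset (Fin n)) := by rw [← h3']; simp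
      have e2 : v'.1 ∈ ({v.1, u} : Finset (Fin n)) := by rw [h3']; simp
      simp only [Finset.mem_insert, Finset.mem_singleton] at e1 e2
      have e1 := e1.resolve_left hvv'
      have e2 := e2.resolve_left hvv'.symm
      have l1 := h2 (e2 ▸ v'.2)
      have l2 := h2' (e1 ▸ v.2)
      rw [← e2] at l1
      rw [← e1] at l2
      exact lt_asymm l1 l2
    · intro w hw
      obtain ⟨v, u, h⟩ := (Finset.mem_filter.1 hw).2
      exact ⟨v, Finset.mem_filter.2 ⟨Finset.mem_univ _, by simp [h]⟩, by simp [h]⟩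
  let T : Finset (Finset (Fin n)) := Sᶜ.powerset ∪ (S.image (fun v => ({v} : Finset (Fin n))) ∪
        Finset.univ.filter fun U : Finset (Fin n) =>
          ∃ v u w', F v = some (u, w') ∧ v.1 ≠ u ∧ U = {v.1, u})
  have hsub : pendantPattern S F ⊆
      {ω | ∀ w, featureUsers ω w ∈ if w ∈ I then {featureUsers ω₀ w} else T} := by
    intro ω hω w
    by_cases hw : w ∈ I
    · rw [if_pos hw, Finset.mem_singleton]
      obtain ⟨v, u, h⟩ := (Finset.mem_filter.1 hw).2
      rw [(hω.1 v u w h).2.2, (hω₀.1 v u w h).2.2]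
    · rw [if_neg hw]
      simp only [T, Finset.mem_union, Finset.mem_image, Finset.mem_filter, Finset.mem_univ,
        true_and]
      rcases hω.2 w with h | ⟨v, hv, h⟩ | h
      · exact Or.inl h
      · exact Or.inr (Or.inl ⟨v, hv, h.symm⟩)
      · exact Or.inr (Or.inr h)
  refine (measureReal_mono hsub).trans ?_
  rw [featureMeasure_real_forall_users_mem]
  have hprod : ∏ v, ((F v).elim 1 fun _ => s / ρ) = ∏ w : Fin m, if w ∈ I then s / ρ else 1 := by
    have h1 : ∏ v, ((F v).elim 1 fun _ => s / ρ) = ∏ v, if v ∈ D then s / ρ else 1 := by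
      refine Finset.prod_congr rfl fun v _ => ?_
      cases h : F v <;> simp [D, h]
    rw [h1, Finset.prod_ite_mem, Finset.prod_ite_mem, Finset.univ_inter, Finset.univ_inter,
      Finset.prod_const, Finset.prod_const, hcard]
  rw [hprod]
  have hpow : ρ ^ m = ∏ _w : Fin m, ρ := by simp
  rw [hpow, ← Finset.prod_mul_distrib]
  refine Finset.prod_le_prod (fun w _ => Finset.sum_nonneg fun U _ => usersWeight_nonneg p U)
    fun w _ => ?_
  by_cases hw : w ∈ I
  · simp only [if_pos hw]
    obtain ⟨v, u, h⟩ := (Finset.mem_filter.1 hw).2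
    obtain ⟨h1, -, h3⟩ := hω₀.1 v u w h
    rw [Finset.sum_singleton, h3, usersWeight_pair _ h1, ← hs, mul_div_cancel₀ _ hρ0.ne']
  · simp only [if_neg hw, mul_one]
    rw [hρ, hs]
    exact sum_usersWeight_le p S F

lemma featureMeasure_real_forall_hasAtMostOneNeighbor_le {n m : ℕ} (p : unitInterval)
    (S : Finset (Fin n)) {s ρ : ℝ} (hs : s = (p : ℝ) ^ 2 * (1 - p) ^ (n - 2))
    (hρ : ρ = (1 - (p : ℝ)) ^ S.card + S.card * ((p : ℝ) * (1 - p) ^ (n - 1)) + S.card * s)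
    (hρ0 : 0 < ρ) :
    (featureMeasure n m p).real {ω | ∀ v ∈ S, HasAtMostOneNeighbor ω v}
      ≤ ρ ^ m * (1 + n * m * (s / ρ)) ^ S.card := by
  classical
  refine (measureReal_mono (forall_hasAtMostOneNeighbor_subset_iUnion S)).trans
    ((measureReal_iUnion_fintype_le _).trans ((Finset.sum_le_sum fun F _ =>
      featureMeasure_real_pendantPattern_le p S F hs hρ hρ0).trans (le_of_eq ?_)))
  rw [← Finset.mul_sum]
  congr 1
  have h := Finset.prod_univ_sum (fun _ : S => (Finset.univ : Finset (Option (Fin n × Fin m))))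
    (fun _ x => x.elim (1 : ℝ) fun _ => s / ρ)
  rw [Fintype.piFinset_univ] at h
  rw [← h]
  simp [Fintype.sum_option]

lemma abs_ite_sub_alternating_sum_choose_le (N K : ℕ) :
    |(if N = 0 then (1 : ℝ) else 0) - ∑ k ∈ Finset.range (K + 1), (-1) ^ k * (N.choose k : ℝ)|
      ≤ N.choose K := by
  rcases N with _ | N
  · rw [Finset.sum_range_succ']
    simp
  · have h := congrArg (Int.cast : ℤ → ℝ) (Int.alternating_sum_range_choose_eq_choose (n := N) (m := K))
    push_cast at h
    rw [h, if_neg (Nat.succ_ne_zero N), zero_sub, abs_neg, abs_mul, abs_pow, abs_neg, abs_one,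
      one_pow, one_mul, Nat.abs_cast]
    exact_mod_cast Nat.choose_le_choose K (Nat.le_succ N)

/-- If the binomial moments of `N n` converge to those of a Poisson law of parameter `l`, then
the probability that `N n` vanishes converges to `exp (-l)`. -/
lemma tendsto_sum_ite_eq_zero_of_binomial_moments {Ω : ℕ → Type*} [∀ n, Fintype (Ω n)]
    (w : ∀ n, Ω n → ℝ) (hw : ∀ n ω, 0 ≤ w n ω) (N : ∀ n, Ω n → ℕ) (l : ℝ)
    (h : ∀ k : ℕ, Tendsto (fun n => ∑ ω, w n ω * ((N n ω).choose k : ℝ)) atTop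
      (𝓝 (l ^ k / k.factorial))) :
    Tendsto (fun n => ∑ ω, w n ω * (if N n ω = 0 then (1 : ℝ) else 0)) atTop
      (𝓝 (Real.exp (-l))) := by
  have hexp : Tendsto (fun K : ℕ => ∑ k ∈ Finset.range (K + 1), (-1 : ℝ) ^ k * (l ^ k / k.factorial))
      atTop (𝓝 (Real.exp (-l))) := by
    have h1 := (NormedSpace.expSeries_div_hasSum_exp (𝔸 := ℝ) (-l)).tendsto_sum_nat
    rw [← Real.exp_eq_exp_ℝ] at h1
    refine ((tendsto_add_atTop_iff_nat 1).2 h1).congr fun K => Finset.sum_congr rfl fun k _ => ?_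
    rw [neg_pow, mul_div_assoc]
  have hfac : Tendsto (fun K : ℕ => l ^ K / K.factorial) atTop (𝓝 0) :=
    FloorSemiring.tendsto_pow_div_factorial_atTop l
  rw [Metric.tendsto_atTop]
  intro ε hε
  obtain ⟨K, hK1, hK2⟩ := ((hexp.eventually (Metric.ball_mem_nhds _ (by positivity : 0 < ε / 4))).and
    (hfac.eventually (gt_mem_nhds (by positivity : 0 < ε / 4)))).exists
  have hsum : Tendsto (fun n => ∑ k ∈ Finset.range (K + 1),
      (-1 : ℝ) ^ k * ∑ ω, w n ω * ((N n ω).choose k : ℝ)) atTop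
      (𝓝 (∑ k ∈ Finset.range (K + 1), (-1 : ℝ) ^ k * (l ^ k / k.factorial))) :=
    tendsto_finsetSum _ fun k _ => (h k).const_mul _
  have hev := (hsum.eventually (Metric.ball_mem_nhds _ (by positivity : 0 < ε / 4))).and
    ((h K).eventually (gt_mem_nhds hK2))
  rw [eventually_atTop] at hev
  obtain ⟨n₀, hn₀⟩ := hev
  refine ⟨n₀, fun n hn => ?_⟩
  obtain ⟨h1, h2⟩ := hn₀ n hn
  have h3 : |∑ ω, w n ω * (if N n ω = 0 then (1 : ℝ) else 0) - ∑ k ∈ Finset.range (K + 1),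
      (-1 : ℝ) ^ k * ∑ ω, w n ω * ((N n ω).choose k : ℝ)|
      ≤ ∑ ω, w n ω * ((N n ω).choose K : ℝ) := by
    have h4 : ∑ k ∈ Finset.range (K + 1), (-1 : ℝ) ^ k * ∑ ω, w n ω * ((N n ω).choose k : ℝ)
        = ∑ ω, w n ω * ∑ k ∈ Finset.range (K + 1), (-1 : ℝ) ^ k * ((N n ω).choose k : ℝ) := by
      simp_rw [Finset.mul_sum]
      rw [Finset.sum_comm]
      exact Finset.sum_congr rfl fun ω _ => Finset.sum_congr rfl fun k _ => by ring
    rw [h4, ← Finset.sum_sub_distrib]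
    refine (Finset.abs_sum_le_sum_abs _ _).trans (Finset.sum_le_sum fun ω _ => ?_)
    rw [← mul_sub, abs_mul, abs_of_nonneg (hw n ω)]
    exact mul_le_mul_of_nonneg_left (abs_ite_sub_alternating_sum_choose_le _ K) (hw n ω)
  rw [Real.dist_eq] at h1 hK1
  rw [Real.dist_eq]
  rw [abs_lt] at h1 hK1 ⊢
  rw [abs_le] at h3
  constructor <;> linarith [h3.1, h3.2, h1.1, h1.2, hK1.1, hK1.2]

/-- Second moment method: if the first binomial moments of `N n` are asymptotic to those of a
Poisson law of parameter `l n → ∞`, then `N n` vanishes with probability tending to `0`. -/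
lemma tendsto_sum_ite_eq_zero_of_second_moment {Ω : ℕ → Type*} [∀ n, Fintype (Ω n)]
    (w : ∀ n, Ω n → ℝ) (hw : ∀ n ω, 0 ≤ w n ω) (N : ∀ n, Ω n → ℕ) (l : ℕ → ℝ)
    (hl : Tendsto l atTop atTop)
    (h : ∀ k : ℕ, Tendsto (fun n => (∑ ω, w n ω * ((N n ω).choose k : ℝ)) / l n ^ k) atTop
      (𝓝 (1 / (k.factorial : ℝ)))) :
    Tendsto (fun n => ∑ ω, w n ω * (if N n ω = 0 then (1 : ℝ) else 0)) atTop (𝓝 0) := by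
  set B : ℕ → ℕ → ℝ := fun k n => (∑ ω, w n ω * ((N n ω).choose k : ℝ)) / l n ^ k with hB
  have hlim : Tendsto (fun n => 2 * B 2 n + B 1 n * (l n)⁻¹ - 2 * B 1 n + B 0 n) atTop
      (𝓝 (2 * (1 / (Nat.factorial 2 : ℕ)) + (1 / (Nat.factorial 1 : ℕ)) * 0
        - 2 * (1 / (Nat.factorial 1 : ℕ)) + 1 / (Nat.factorial 0 : ℕ))) :=
    ((((h 2).const_mul 2).add ((h 1).mul (tendsto_inv_atTop_zero.comp hl))).sub
      ((h 1).const_mul 2)).add (h 0)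
  have h0 : (2 * (1 / ((Nat.factorial 2 : ℕ) : ℝ)) + (1 / ((Nat.factorial 1 : ℕ) : ℝ)) * 0
        - 2 * (1 / ((Nat.factorial 1 : ℕ) : ℝ)) + 1 / ((Nat.factorial 0 : ℕ) : ℝ)) = 0 := by
    norm_num [Nat.factorial]
  rw [h0] at hlim
  refine squeeze_zero' (Eventually.of_forall fun n => Finset.sum_nonneg fun ω _ =>
    mul_nonneg (hw n ω) (by split_ifs <;> norm_num)) ?_ hlim
  filter_upwards [hl.eventually_gt_atTop 0] with n hn
  have hid : 2 * B 2 n + B 1 n * (l n)⁻¹ - 2 * B 1 n + B 0 n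
      = ∑ ω, w n ω * ((N n ω : ℝ) / l n - 1) ^ 2 := by
    simp only [hB, Finset.sum_div, Finset.sum_mul, Finset.mul_sum]
    rw [← Finset.sum_add_distrib, ← Finset.sum_sub_distrib, ← Finset.sum_add_distrib]
    refine Finset.sum_congr rfl fun ω _ => ?_
    rw [Nat.choose_one_right, Nat.choose_zero_right, Nat.cast_choose_two]
    field_simp
    push_cast
    ring
  rw [hid]
  refine Finset.sum_le_sum fun ω _ => mul_le_mul_of_nonneg_left ?_ (hw n ω)
  by_cases hN : N n ω = 0
  · simp [hN]
  · rw [if_neg hN]; positivity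

/-- The number of vertices of degree at most one. -/
noncomputable def numSmallDegree {n m : ℕ} (ω : FeatureChoice n m) : ℕ :=
  haveI : DecidablePred fun v => HasAtMostOneNeighbor ω v := Classical.decPred _
  (Finset.univ.filter fun v => HasAtMostOneNeighbor ω v).card

lemma sum_choose_numSmallDegree {n m : ℕ} (p : unitInterval) (k : ℕ) :
    ∑ ω, (featureMeasure n m p).real {ω} * ((numSmallDegree ω).choose k : ℝ)
      = ∑ S ∈ Finset.powersetCard k (Finset.univ : Finset (Fin n)),
        (featureMeasure n m p).real {ω | ∀ v ∈ S, HasAtMostOneNeighbor ω v} := by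
  classical
  have h : ∀ ω : FeatureChoice n m, ((numSmallDegree ω).choose k : ℝ)
      = ∑ S ∈ Finset.powersetCard k (Finset.univ : Finset (Fin n)),
        if ω ∈ {ω | ∀ v ∈ S, HasAtMostOneNeighbor ω v} then (1 : ℝ) else 0 := by
    intro ω
    rw [Finset.sum_boole, numSmallDegree, ← Finset.card_powersetCard]
    congr 2
    ext S
    simp only [Finset.mem_powersetCard, Finset.mem_filter, true_and,
      Finset.subset_iff, Finset.mem_univ, Set.mem_ofPred_eq]
    tauto
  simp_rw [h, Finset.mul_sum]
  rw [Finset.sum_comm]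
  exact Finset.sum_congr rfl fun S _ => (featureMeasure_real_eq_sum p _).symm

lemma probMinDegreeGeTwo_eq_sum {n m : ℕ} [NeZero n] (p : unitInterval) :
    probMinDegreeGeTwo n m p = ∑ ω, (featureMeasure n m p).real {ω}
      * (if numSmallDegree ω = 0 then (1 : ℝ) else 0) := by
  classical
  rw [probMinDegreeGeTwo, featureMeasure_real_eq_sum]
  refine Finset.sum_congr rfl fun ω _ => ?_
  congr 1
  refine if_congr ?_ rfl rfl
  rw [Set.mem_ofPred_eq, two_le_minDegree_iff, numSmallDegree, Finset.card_eq_zero,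
    Finset.filter_eq_empty_iff]
  simp

/-- The probability that a feature is chosen by a given vertex and by at least one other. -/
noncomputable def sharedProb (n : ℕ) (p : ℝ) : ℝ := p * (1 - (1 - p) ^ (n - 1))

/-- The probability that the users of a feature are two given vertices. -/
noncomputable def pairProb (n : ℕ) (p : ℝ) : ℝ := p ^ 2 * (1 - p) ^ (n - 2)

/-- The asymptotic value of the expected number of vertices of degree at most one. -/
noncomputable def smallDegreeMean (n m : ℕ) (p : ℝ) : ℝ :=
  n * (Real.exp (-(m * sharedProb n p)) * (1 + n * (m * pairProb n p)))

lemma sharedProb_nonneg (n : ℕ) (p : unitInterval) : 0 ≤ sharedProb n p :=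
  mul_nonneg p.2.1 (sub_nonneg.2 (pow_le_one₀ (by linarith [p.2.2]) (by linarith [p.2.1])))

lemma sharedProb_le (n : ℕ) (p : unitInterval) : sharedProb n p ≤ p :=
  mul_le_of_le_one_right p.2.1 (sub_le_self _ (pow_nonneg (by linarith [p.2.2]) _))

lemma pairProb_nonneg (n : ℕ) (p : unitInterval) : 0 ≤ pairProb n p :=
  mul_nonneg (sq_nonneg _) (pow_nonneg (by linarith [p.2.2]) _)

lemma smallDegreeMean_pos {n : ℕ} (hn : 0 < n) (m : ℕ) (p : unitInterval) :
    0 < smallDegreeMean n m p := by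
  have := pairProb_nonneg n p
  unfold smallDegreeMean
  positivity

lemma mul_smallDegreeMean_le_featureMeasure_real {n m : ℕ} (p : unitInterval) (v : Fin n) :
    (1 - (m : ℝ) * (p : ℝ) ^ 2) * (1 - 1 / n)
        * (Real.exp (-(m * sharedProb n p)) * (1 + n * (m * pairProb n p)))
      ≤ (featureMeasure n m p).real {ω | HasAtMostOneNeighbor ω v} := by
  have hn : (1 : ℝ) ≤ n := by exact_mod_cast (Nat.succ_le_iff.2 (lt_of_le_of_lt (Nat.zero_le _) v.2))
  refine le_trans ?_ (le_featureMeasure_real_hasAtMostOneNeighbor p v)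
  change _ ≤ (1 - sharedProb n p) ^ m * (1 + (n - 1 : ℝ) * (m * pairProb n p))
  set q := sharedProb n p with hq
  set s := pairProb n p with hs
  have hq0 : 0 ≤ q := sharedProb_nonneg n p
  have hqp : q ≤ p := sharedProb_le n p
  have hs0 : 0 ≤ s := pairProb_nonneg n p
  have hp1 : (p : ℝ) ≤ 1 := p.2.2
  have hq1 : q ≤ 1 := hqp.trans hp1
  have h1 : (1 - (m : ℝ) * (p : ℝ) ^ 2) * Real.exp (-(m * q)) ≤ (1 - q) ^ m := by
    rw [Real.exp_neg, ← div_eq_mul_inv, div_le_iff₀ (Real.exp_pos _), Real.exp_nat_mul, ← mul_pow]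
    have h2 : 1 - q ^ 2 ≤ (1 - q) * Real.exp q := by
      have := mul_le_mul_of_nonneg_left (Real.add_one_le_exp q) (by linarith : 0 ≤ 1 - q)
      nlinarith
    have h3 : 1 + (m : ℝ) * (-q ^ 2) ≤ (1 + -q ^ 2) ^ m :=
      one_add_mul_le_pow (by nlinarith) m
    have h4 : (1 + -q ^ 2) ^ m ≤ ((1 - q) * Real.exp q) ^ m :=
      pow_le_pow_left₀ (by nlinarith) (by linarith) m
    have h5 : (m : ℝ) * q ^ 2 ≤ m * (p : ℝ) ^ 2 := by gcongr
    linarith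
  have h6 : (1 - 1 / (n : ℝ)) * (1 + n * (m * s)) ≤ 1 + (n - 1 : ℝ) * (m * s) := by
    have h7 : (1 - 1 / (n : ℝ)) * (1 + n * (m * s)) = 1 - 1 / (n : ℝ) + (n - 1 : ℝ) * (m * s) := by
      field_simp
    rw [h7]
    have : 0 ≤ 1 / (n : ℝ) := by positivity
    linarith
  have h8 : 0 ≤ (1 - 1 / (n : ℝ)) * (1 + n * (m * s)) := by
    have : 1 / (n : ℝ) ≤ 1 := by rw [div_le_one (by linarith)]; exact hn
    exact mul_nonneg (by linarith) (by positivity)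
  calc _ = ((1 - (m : ℝ) * (p : ℝ) ^ 2) * Real.exp (-(m * q)))
        * ((1 - 1 / (n : ℝ)) * (1 + n * (m * s))) := by ring
    _ ≤ _ := mul_le_mul h1 h6 h8 (pow_nonneg (by linarith) _)

lemma one_sub_pow_le {x : ℝ} (h0 : 0 ≤ x) (h1 : x ≤ 1) (k : ℕ) :
    (1 - x) ^ k ≤ 1 - k * x + (k : ℝ) ^ 2 * x ^ 2 := by
  induction k with
  | zero => simp
  | succ k ih =>
    have h2 := mul_le_mul_of_nonneg_right ih (by linarith : 0 ≤ 1 - x)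
    have h3 : 0 ≤ (k : ℝ) ^ 2 * x ^ 2 * x := by positivity
    have h4 : 0 ≤ (k : ℝ) * x ^ 2 := by positivity
    rw [pow_succ]
    push_cast
    nlinarith [sq_nonneg x]

lemma featureMeasure_real_le_mul_smallDegreeMean {n m : ℕ} (p : unitInterval) (S : Finset (Fin n))
    (h : (S.card : ℝ) * p < 1) :
    (featureMeasure n m p).real {ω | ∀ v ∈ S, HasAtMostOneNeighbor ω v}
      ≤ Real.exp (((S.card : ℝ) ^ 2 + S.card) * (m * (p : ℝ) ^ 2)) / (1 - S.card * p) ^ S.card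
        * (Real.exp (-(m * sharedProb n p)) * (1 + n * (m * pairProb n p))) ^ S.card := by
  set k := S.card with hk
  set q := sharedProb n p with hq
  set s := pairProb n p with hs
  have hp0 : 0 ≤ (p : ℝ) := p.2.1
  have hp1 : (p : ℝ) ≤ 1 := p.2.2
  have hs0 : 0 ≤ s := pairProb_nonneg n p
  have hsp : s ≤ (p : ℝ) ^ 2 :=
    mul_le_of_le_one_right (sq_nonneg _) (pow_le_one₀ (by linarith) (by linarith))
  have hr0 : 0 ≤ (1 - (p : ℝ)) ^ (n - 1) := pow_nonneg (by linarith) _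
  set ρ := (1 - (p : ℝ)) ^ k + k * ((p : ℝ) * (1 - p) ^ (n - 1)) + k * s with hρ
  have hρge : 1 - k * (p : ℝ) ≤ ρ := by
    have h1 := one_add_mul_le_pow (by linarith : -2 ≤ -(p : ℝ)) k
    have h2 : 0 ≤ k * ((p : ℝ) * (1 - p) ^ (n - 1)) + k * s := by positivity
    rw [← sub_eq_add_neg] at h1
    linarith
  have hθ : 0 < 1 - k * (p : ℝ) := by linarith
  have hθ1 : 1 - k * (p : ℝ) ≤ 1 := by
    have : 0 ≤ k * (p : ℝ) := by positivity
    linarith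
  have hρ0 : 0 < ρ := hθ.trans_le hρge
  have hρle : ρ ≤ 1 + (-(k * q) + ((k : ℝ) ^ 2 + k) * (p : ℝ) ^ 2) := by
    have h1 := one_sub_pow_le hp0 hp1 k
    have h2 : (k : ℝ) * s ≤ k * (p : ℝ) ^ 2 := by gcongr
    have h3 : q = p - p * (1 - p) ^ (n - 1) := by rw [hq, sharedProb]; ring
    rw [h3]
    nlinarith
  have hpow : ρ ^ m ≤ Real.exp (((k : ℝ) ^ 2 + k) * (m * (p : ℝ) ^ 2))
      * Real.exp (-(m * q)) ^ k := by
    have h1 : ρ ≤ Real.exp (-(k * q) + ((k : ℝ) ^ 2 + k) * (p : ℝ) ^ 2) := by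
      have := Real.add_one_le_exp (-(k * q) + ((k : ℝ) ^ 2 + k) * (p : ℝ) ^ 2)
      linarith
    refine (pow_le_pow_left₀ hρ0.le h1 m).trans (le_of_eq ?_)
    rw [← Real.exp_nat_mul, ← Real.exp_nat_mul, ← Real.exp_add]
    congr 1
    ring
  have hfac : 1 + n * m * (s / ρ) ≤ (1 + n * (m * s)) / (1 - k * p) := by
    have h1 : s / ρ ≤ s / (1 - k * p) := div_le_div_of_nonneg_left hs0 hθ hρge
    have h2 : 1 ≤ 1 / (1 - k * (p : ℝ)) := by rw [le_div_iff₀ hθ]; linarith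
    have h3 : (n : ℝ) * m * (s / ρ) ≤ n * m * (s / (1 - k * p)) := by gcongr
    calc 1 + n * m * (s / ρ) ≤ 1 / (1 - k * (p : ℝ)) + n * m * (s / (1 - k * p)) := by linarith
      _ = _ := by ring
  refine (featureMeasure_real_forall_hasAtMostOneNeighbor_le p S (s := s) (ρ := ρ) rfl hρ hρ0).trans ?_
  have h0 : 0 ≤ 1 + n * m * (s / ρ) := by positivity
  calc ρ ^ m * (1 + n * m * (s / ρ)) ^ k
      ≤ (Real.exp (((k : ℝ) ^ 2 + k) * (m * (p : ℝ) ^ 2)) * Real.exp (-(m * q)) ^ k)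
        * ((1 + n * (m * s)) / (1 - k * p)) ^ k :=
        mul_le_mul hpow (pow_le_pow_left₀ h0 hfac k) (pow_nonneg h0 k) (by positivity)
    _ = _ := by rw [div_pow, mul_pow]; ring

lemma tendsto_binomial_moment_div_pow {m : ℕ → ℕ} {p : ℕ → unitInterval}
    (hp : Tendsto (fun n => (p n : ℝ)) atTop (𝓝 0))
    (hmp : Tendsto (fun n => (m n : ℝ) * (p n : ℝ) ^ 2) atTop (𝓝 0)) (k : ℕ) :
    Tendsto (fun n => (∑ ω, (featureMeasure n (m n) (p n)).real {ω}
        * ((numSmallDegree ω).choose k : ℝ)) / smallDegreeMean n (m n) (p n) ^ k) atTop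
      (𝓝 (1 / (k.factorial : ℝ))) := by
  have hch : Tendsto (fun n : ℕ => (n.choose k : ℝ) / (n : ℝ) ^ k) atTop (𝓝 (1 / (k.factorial : ℝ))) := by
    have h1 := (isEquivalent_choose k)
    rw [isEquivalent_iff_tendsto_one] at h1
    · have h2 := h1.mul_const (1 / (k.factorial : ℝ))
      rw [one_mul] at h2
      refine h2.congr' ?_
      filter_upwards [eventually_gt_atTop 0] with n hn
      have : (n : ℝ) ≠ 0 := by positivity
      simp only [Pi.div_apply]
      field_simp
    · filter_upwards [eventually_gt_atTop 0] with n hn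
      positivity
  have hinv : Tendsto (fun n : ℕ => 1 / (n : ℝ)) atTop (𝓝 0) := tendsto_one_div_atTop_nhds_zero_nat
  have hlow : Tendsto (fun n : ℕ => (n.choose k : ℝ) / (n : ℝ) ^ k
      * ((1 - (m n : ℝ) * (p n : ℝ) ^ 2) * (1 - 1 / n)) ^ k) atTop (𝓝 (1 / (k.factorial : ℝ))) := by
    simpa using hch.mul (((hmp.const_sub 1).mul (hinv.const_sub 1)).pow k)
  have hupp : Tendsto (fun n : ℕ => (n.choose k : ℝ) / (n : ℝ) ^ k
      * (Real.exp (((k : ℝ) ^ 2 + k) * ((m n : ℝ) * (p n : ℝ) ^ 2)) / (1 - k * p n) ^ k)) atTop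
      (𝓝 (1 / (k.factorial : ℝ))) := by
    have h1 := ((Real.continuous_exp.tendsto _).comp (hmp.const_mul ((k : ℝ) ^ 2 + k)))
    have h2 := ((hp.const_mul (k : ℝ)).const_sub 1).pow k
    have h3 := hch.mul (h1.div h2 (by simp))
    simpa using h3
  refine tendsto_of_tendsto_of_tendsto_of_le_of_le' hlow hupp ?_ ?_
  · filter_upwards [eventually_gt_atTop 0, hmp.eventually (gt_mem_nhds one_pos)] with n hn hd
    have hl := smallDegreeMean_pos hn (m n) (p n)
    have hn' : (0 : ℝ) < n := by exact_mod_cast hn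
    have hn1 : 0 ≤ 1 - 1 / (n : ℝ) := by
      rw [sub_nonneg, div_le_one hn']; exact_mod_cast hn
    set y := Real.exp (-(m n * sharedProb n (p n))) * (1 + n * (m n * pairProb n (p n))) with hy
    have hy0 : 0 ≤ y := by have := pairProb_nonneg n (p n); positivity
    have hlam : smallDegreeMean n (m n) (p n) = n * y := rfl
    rw [le_div_iff₀ (pow_pos hl k), sum_choose_numSmallDegree]
    calc _ = ∑ S ∈ Finset.powersetCard k (Finset.univ : Finset (Fin n)),
          ((1 - (m n : ℝ) * (p n : ℝ) ^ 2) * (1 - 1 / n) * y) ^ k := by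
          rw [Finset.sum_const, Finset.card_powersetCard, Finset.card_univ, Fintype.card_fin,
            nsmul_eq_mul, hlam]
          generalize (1 - (m n : ℝ) * (p n : ℝ) ^ 2) * (1 - 1 / (n : ℝ)) = z
          clear_value y
          rw [mul_pow, mul_pow]
          field_simp
      _ ≤ _ := Finset.sum_le_sum fun S hS => by
          rw [← (Finset.mem_powersetCard.1 hS).2, ← Finset.prod_const]
          refine le_trans (Finset.prod_le_prod (fun v _ => ?_) fun v _ =>
            mul_smallDegreeMean_le_featureMeasure_real (p n) v)
            (prod_le_featureMeasure_real_forall (p n) S)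
          exact mul_nonneg (mul_nonneg (by linarith) hn1) hy0
  · have hk : Tendsto (fun n => (k : ℝ) * (p n : ℝ)) atTop (𝓝 0) := by
      simpa using hp.const_mul (k : ℝ)
    filter_upwards [eventually_gt_atTop 0, hk.eventually (gt_mem_nhds one_pos)] with n hn hkp
    have hl := smallDegreeMean_pos hn (m n) (p n)
    have hn' : (0 : ℝ) < n := by exact_mod_cast hn
    set y := Real.exp (-(m n * sharedProb n (p n))) * (1 + n * (m n * pairProb n (p n))) with hy
    have hlam : smallDegreeMean n (m n) (p n) = n * y := rfl
    rw [div_le_iff₀ (pow_pos hl k), sum_choose_numSmallDegree]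
    calc _ ≤ ∑ S ∈ Finset.powersetCard k (Finset.univ : Finset (Fin n)),
          Real.exp (((k : ℝ) ^ 2 + k) * ((m n : ℝ) * (p n : ℝ) ^ 2)) / (1 - k * p n) ^ k
            * y ^ k := Finset.sum_le_sum fun S hS => by
          have hS' := (Finset.mem_powersetCard.1 hS).2
          have := featureMeasure_real_le_mul_smallDegreeMean (m := m n) (p n) S (by rwa [hS'])
          rwa [hS'] at this
      _ = _ := by
          rw [Finset.sum_const, Finset.card_powersetCard, Finset.card_univ, Fintype.card_fin,
            nsmul_eq_mul, hlam]
          clear_value y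
          rw [mul_pow]
          field_simp

/-- If `m p² → 0` the limit of the probability of minimum degree at least two is governed by the
asymptotic mean number of vertices of degree at most one. -/
lemma tendsto_probMinDegreeGeTwo_of_smallDegreeMean {m : ℕ → ℕ} {p : ℕ → unitInterval}
    (hp : Tendsto (fun n => (p n : ℝ)) atTop (𝓝 0))
    (hmp : Tendsto (fun n => (m n : ℝ) * (p n : ℝ) ^ 2) atTop (𝓝 0)) :
    (∀ l : ℝ, Tendsto (fun n => smallDegreeMean n (m n) (p n)) atTop (𝓝 l) →
      Tendsto (fun n => probMinDegreeGeTwo n (m n) (p n)) atTop (𝓝 (Real.exp (-l)))) ∧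
    (Tendsto (fun n => smallDegreeMean n (m n) (p n)) atTop atTop →
      Tendsto (fun n => probMinDegreeGeTwo n (m n) (p n)) atTop (𝓝 0)) := by
  have hprob : (fun n => ∑ ω, (featureMeasure n (m n) (p n)).real {ω}
      * (if numSmallDegree ω = 0 then (1 : ℝ) else 0))
      =ᶠ[atTop] fun n => probMinDegreeGeTwo n (m n) (p n) := by
    filter_upwards [eventually_gt_atTop 0] with n hn
    have : NeZero n := ⟨hn.ne'⟩
    exact (probMinDegreeGeTwo_eq_sum (p n)).symm
  constructor
  · intro l hl
    refine Tendsto.congr' hprob (tendsto_sum_ite_eq_zero_of_binomial_moments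
      (fun n ω => (featureMeasure n (m n) (p n)).real {ω}) (fun _ _ => measureReal_nonneg)
      (fun _ ω => numSmallDegree ω) l fun k => ?_)
    have h := (tendsto_binomial_moment_div_pow hp hmp k).mul (hl.pow k)
    rw [one_div_mul_eq_div] at h
    refine h.congr' ?_
    filter_upwards [eventually_gt_atTop 0] with n hn
    exact div_mul_cancel₀ _ (pow_pos (smallDegreeMean_pos hn (m n) (p n)) k).ne'
  · intro hl
    exact Tendsto.congr' hprob (tendsto_sum_ite_eq_zero_of_second_moment
      (fun n ω => (featureMeasure n (m n) (p n)).real {ω}) (fun _ _ => measureReal_nonneg)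
      (fun _ ω => numSmallDegree ω) _ hl fun k => tendsto_binomial_moment_div_pow hp hmp k)

lemma tendsto_log_natCast_atTop : Tendsto (fun n : ℕ => Real.log n) atTop atTop :=
  Real.tendsto_log_atTop.comp tendsto_natCast_atTop_atTop

lemma tendsto_log_log_natCast_atTop : Tendsto (fun n : ℕ => Real.log (Real.log n)) atTop atTop :=
  Real.tendsto_log_atTop.comp tendsto_log_natCast_atTop

lemma isLittleO_log_log_natCast :
    (fun n : ℕ => Real.log (Real.log n)) =o[atTop] fun n : ℕ => Real.log n :=
  Real.isLittleO_log_id_atTop.comp_tendsto tendsto_log_natCast_atTop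

lemma tendsto_log_sq_div_natCast : Tendsto (fun n : ℕ => Real.log n ^ 2 / n) atTop (𝓝 0) :=
  ((Real.isLittleO_pow_log_id_atTop (n := 2)).comp_tendsto
    tendsto_natCast_atTop_atTop).tendsto_div_nhds_zero

lemma mul_le_sharedProb_mul {n : ℕ} (hn : 1 ≤ n) {p : ℝ} (h0 : 0 ≤ p) (h1 : p ≤ 1) :
    p * ((n - 1 : ℝ) * p) ≤ sharedProb n p * (1 + (n - 1 : ℝ) * p) := by
  have hn' : (0 : ℝ) ≤ n - 1 := by
    rw [sub_nonneg]; exact_mod_cast hn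
  set y := (n - 1 : ℝ) * p with hy
  have hy0 : 0 ≤ y := mul_nonneg hn' h0
  have hr : (1 - p) ^ (n - 1) ≤ Real.exp (-y) := by
    have h2 : (1 - p) ^ (n - 1) ≤ Real.exp (-p) ^ (n - 1) :=
      pow_le_pow_left₀ (by linarith) (by linarith [Real.add_one_le_exp (-p)]) _
    rw [← Real.exp_nat_mul, Nat.cast_sub hn, Nat.cast_one] at h2
    rwa [hy, ← mul_neg]
  have hy1 : Real.exp (-y) * (1 + y) ≤ 1 := by
    have h3 := mul_le_mul_of_nonneg_left (Real.add_one_le_exp y) (Real.exp_pos (-y)).le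
    rw [← Real.exp_add, neg_add_cancel, Real.exp_zero] at h3
    linarith
  have h4 := mul_le_mul_of_nonneg_right hr (by linarith : 0 ≤ 1 + y)
  have h5 : y ≤ (1 - (1 - p) ^ (n - 1)) * (1 + y) := by linarith
  rw [sharedProb, mul_assoc]
  exact mul_le_mul_of_nonneg_left h5 h0

lemma mul_sq_le_of_mul_sharedProb_le {n : ℕ} (hn : 2 ≤ n) {m p L : ℝ} (hm : 0 < m) (h0 : 0 ≤ p)
    (h1 : p ≤ 1) (h : m * sharedProb n p ≤ 2 * L) :
    m * p ^ 2 ≤ 4 * L / (n - 1) + 4 * (L ^ 2 / m) := by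
  have hn' : (0 : ℝ) < n - 1 := by
    have : (2 : ℝ) ≤ n := by exact_mod_cast hn
    linarith
  have h2 := mul_le_mul_of_nonneg_left (mul_le_sharedProb_mul (by omega : 1 ≤ n) h0 h1) hm.le
  have h3 := mul_le_mul_of_nonneg_right h (by positivity : 0 ≤ 1 + (n - 1 : ℝ) * p)
  have h4 : m * p ^ 2 ≤ 2 * L / (n - 1) + 2 * L * p := by
    have e : 2 * L / (n - 1) + 2 * L * p = 2 * L * (1 + (n - 1 : ℝ) * p) / (n - 1) := by
      field_simp
    rw [e, le_div_iff₀ hn']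
    linarith
  have h5 : 2 * L * p ≤ m * p ^ 2 / 2 + 2 * (L ^ 2 / m) := by
    have e : m * p ^ 2 / 2 + 2 * (L ^ 2 / m) - 2 * L * p = (m * p - 2 * L) ^ 2 / (2 * m) := by
      field_simp
      ring
    have : 0 ≤ (m * p - 2 * L) ^ 2 / (2 * m) := by positivity
    linarith
  have e : 4 * L / (n - 1 : ℝ) = 2 * (2 * L / (n - 1)) := by ring
  rw [e]
  linarith

/-- With few features pendant vertices are negligible with respect to isolated ones. -/
lemma tendsto_mul_pairProb_of_few_features {l : Filter ℕ} (hl : l ≤ atTop) {m : ℕ → ℕ}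
    {p c : ℕ → ℝ} {ε : ℝ} (hε : 0 < ε) (hp : ∀ᶠ n in l, 0 < p n ∧ p n < 1)
    (hm0 : ∀ᶠ n in l, 0 < m n)
    (hm : ∀ᶠ n : ℕ in l,
      (m n : ℝ) < (1 - ε) * (n * Real.log n / Real.log (Real.log n)))
    (hc : c =o[l] fun n : ℕ => Real.log n)
    (heq : ∀ᶠ n : ℕ in l, (m n : ℝ) * sharedProb n (p n) = Real.log n + c n) :
    Tendsto (fun n : ℕ => n * ((m n : ℝ) * pairProb n (p n))) l (𝓝 0) := by
  have hL := (tendsto_log_natCast_atTop.mono_left hl).eventually_gt_atTop 0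
  have hLL := (tendsto_log_log_natCast_atTop.mono_left hl).eventually_gt_atTop 0
  have hn2 : ∀ᶠ n in l, 2 ≤ n := hl (eventually_ge_atTop 2)
  have hx : ∀ᶠ n : ℕ in l, (1 + ε) * Real.log (Real.log n) ≤ n * p n := by
    filter_upwards [hL, hLL, hn2, hp, hm0, hm, heq,
      hc.bound (by positivity : 0 < ε ^ 2)] with n hL hLL hn2 hp hm0 hm heq hc
    rw [Real.norm_eq_abs, Real.norm_eq_abs, abs_of_pos hL] at hc
    have hn0 : (0 : ℝ) < n := by exact_mod_cast (by omega : 0 < n)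
    have hm0' : (0 : ℝ) < m n := by exact_mod_cast hm0
    have hX : 0 < (n : ℝ) * Real.log n / Real.log (Real.log n) := by positivity
    have hε1 : 0 < 1 - ε := by
      by_contra h
      push Not at h
      nlinarith
    have hqp : sharedProb n (p n) ≤ p n := mul_le_of_le_one_right hp.1.le
      (sub_le_self _ (pow_nonneg (by linarith) _))
    have h1 : (1 - ε ^ 2) * Real.log n ≤ m n * p n := by
      have := mul_le_mul_of_nonneg_left hqp hm0'.le
      linarith [(abs_le.1 hc).1]
    have h2 : (m n : ℝ) * p n ≤ (1 - ε) * (n * Real.log n / Real.log (Real.log n)) * p n :=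
      mul_le_mul_of_nonneg_right hm.le hp.1.le
    have h3 := h1.trans h2
    rw [show (1 - ε) * (n * Real.log n / Real.log (Real.log n)) * p n
      = (1 - ε) * Real.log n * (n * p n) / Real.log (Real.log n) by ring, le_div_iff₀ hLL] at h3
    have h4 : (1 - ε) * Real.log n * ((1 + ε) * Real.log (Real.log n))
        ≤ (1 - ε) * Real.log n * (n * p n) := by linarith
    exact le_of_mul_le_mul_left h4 (by positivity)
  have hxlim : Tendsto (fun n : ℕ => (n : ℝ) * p n) l atTop :=
    tendsto_atTop_mono' l hx
      ((tendsto_log_log_natCast_atTop.mono_left hl).const_mul_atTop (by positivity))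
  have hb : 0 < ε / (1 + ε) := by positivity
  have hlim : Tendsto (fun n : ℕ => 4 * Real.exp 2 *
      (((n : ℝ) * p n) ^ (1 : ℝ) * Real.exp (-(ε / (1 + ε)) * ((n : ℝ) * p n)))) l (𝓝 0) := by
    simpa using ((tendsto_rpow_mul_exp_neg_mul_atTop_nhds_zero 1 _ hb).comp hxlim).const_mul
      (4 * Real.exp 2)
  have hex : ∀ᶠ n : ℕ in l, Real.exp 1 * Real.exp (-((n : ℝ) * p n)) < 1 / 2 := by
    have h1 : Tendsto (fun n : ℕ => Real.exp 1 * Real.exp (-((n : ℝ) * p n))) l (𝓝 0) := by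
      simpa using (Real.tendsto_exp_neg_atTop_nhds_zero.comp hxlim).const_mul (Real.exp 1)
    exact h1.eventually (gt_mem_nhds (by norm_num))
  refine squeeze_zero' ?_ ?_ hlim
  · filter_upwards [hp] with n hp
    have : 0 ≤ pairProb n (p n) := mul_nonneg (sq_nonneg _) (pow_nonneg (by linarith) _)
    positivity
  filter_upwards [hL, hLL, hn2, hp, hm0, heq, hc.bound one_pos, hx, hex] with
    n hL hLL hn2 hp hm0 heq hc hx hex
  rw [Real.norm_eq_abs, Real.norm_eq_abs, abs_of_pos hL, one_mul] at hc
  have hm0' : (0 : ℝ) < m n := by exact_mod_cast hm0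
  have hpow : ∀ j : ℕ, j ≤ n → (1 - p n) ^ (n - j) ≤ Real.exp j * Real.exp (-(n * p n)) := by
    intro j hj
    have h2 : (1 - p n) ^ (n - j) ≤ Real.exp (-p n) ^ (n - j) :=
      pow_le_pow_left₀ (by linarith) (by linarith [Real.add_one_le_exp (-p n)]) _
    refine h2.trans ?_
    rw [← Real.exp_nat_mul, Nat.cast_sub hj, ← Real.exp_add, Real.exp_le_exp]
    have : (j : ℝ) * p n ≤ j * 1 := by gcongr; exact hp.2.le
    linarith
  have hr := hpow 1 (by omega)
  have hr2 := hpow 2 hn2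
  rw [Nat.cast_one] at hr
  rw [Nat.cast_two] at hr2
  have hmp : (m n : ℝ) * p n ≤ 4 * Real.log n := by
    have h1 : p n / 2 ≤ sharedProb n (p n) := by
      rw [sharedProb, div_eq_mul_inv]
      exact mul_le_mul_of_nonneg_left (by linarith) hp.1.le
    have h2 := mul_le_mul_of_nonneg_left h1 hm0'.le
    linarith [(abs_le.1 hc).2]
  have hLx : Real.log n ≤ Real.exp (n * p n / (1 + ε)) := by
    conv_lhs => rw [← Real.exp_log hL]
    rw [Real.exp_le_exp, le_div_iff₀ (by positivity)]
    linarith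
  have hx0 : 0 < (n : ℝ) * p n := lt_of_lt_of_le (by positivity) hx
  have hexp : Real.exp (-(ε / (1 + ε)) * ((n : ℝ) * p n))
      = Real.exp (n * p n / (1 + ε)) * Real.exp (-(n * p n)) := by
    rw [← Real.exp_add]
    congr 1
    field_simp
    ring
  rw [Real.rpow_one, hexp]
  calc (n : ℝ) * (m n * pairProb n (p n))
      = (n * p n) * (m n * p n) * (1 - p n) ^ (n - 2) := by rw [pairProb]; ring
    _ ≤ (n * p n) * (4 * Real.exp (n * p n / (1 + ε))) * (Real.exp 2 * Real.exp (-(n * p n))) :=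
         mul_le_mul (mul_le_mul_of_nonneg_left (by linarith) hx0.le) hr2
          (pow_nonneg (by linarith) _) (by positivity)
    _ = _ := by ring

lemma abs_one_sub_pow_mul_exp_sub_one_le {n : ℕ} (hn : 1 ≤ n) {p : ℝ} (h0 : 0 ≤ p)
    (h1 : p ≤ 1 / 2) :
    |(1 - p) ^ (n - 1) * Real.exp (n * p) - 1| ≤ 2 * p + n * p ^ 2 := by
  have hexp : Real.exp (n * p) = Real.exp p ^ (n - 1) * Real.exp p := by
    rw [← pow_succ, Nat.sub_add_cancel hn, ← Real.exp_nat_mul]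
  have hup : (1 - p) * Real.exp p ≤ 1 := by
    have h3 := mul_le_mul_of_nonneg_right (Real.add_one_le_exp (-p)) (Real.exp_pos p).le
    rw [← Real.exp_add, neg_add_cancel, Real.exp_zero] at h3
    linarith
  have hlow : 1 - p ^ 2 ≤ (1 - p) * Real.exp p := by
    have := mul_le_mul_of_nonneg_left (Real.add_one_le_exp p) (by linarith : 0 ≤ 1 - p)
    nlinarith
  have he2 : Real.exp p ≤ 1 + 2 * p := by nlinarith
  have he1 : 1 ≤ Real.exp p := Real.one_le_exp h0
  rw [hexp, ← mul_assoc, ← mul_pow]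
  have hA1 : ((1 - p) * Real.exp p) ^ (n - 1) ≤ 1 :=
    pow_le_one₀ (mul_nonneg (by linarith) (Real.exp_pos p).le) hup
  have hA2 : 1 - n * p ^ 2 ≤ ((1 - p) * Real.exp p) ^ (n - 1) := by
    have h3 : 1 + ((n - 1 : ℕ) : ℝ) * (-p ^ 2) ≤ (1 + -p ^ 2) ^ (n - 1) :=
      one_add_mul_le_pow (by nlinarith) (n - 1)
    have h4 : (1 + -p ^ 2) ^ (n - 1) ≤ ((1 - p) * Real.exp p) ^ (n - 1) :=
      pow_le_pow_left₀ (by nlinarith) (by linarith) _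
    have h5 : ((n - 1 : ℕ) : ℝ) * p ^ 2 ≤ n * p ^ 2 := by
      gcongr; omega
    linarith
  have hA0 : 0 ≤ ((1 - p) * Real.exp p) ^ (n - 1) :=
    pow_nonneg (mul_nonneg (by linarith) (Real.exp_pos p).le) _
  have hnp : 0 ≤ (n : ℝ) * p ^ 2 := by positivity
  rw [abs_le]
  constructor <;> nlinarith

/-- With many features the expected numbers of isolated and of pendant vertices are in the
proportion `1 : a n`, and `a n → ∞`. -/
lemma tendsto_one_add_mul_pairProb_div_of_many_features {l : Filter ℕ} (hl : l ≤ atTop)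
    {m : ℕ → ℕ} {p a c : ℕ → ℝ} {ε : ℝ} (hε : 0 < ε) (hp : ∀ᶠ n in l, 0 < p n ∧ p n < 1)
    (hm0 : ∀ᶠ n in l, 0 < m n)
    (hm : ∀ᶠ n : ℕ in l,
      (1 + ε) * (n * Real.log n / Real.log (Real.log n)) < (m n : ℝ))
    (ha : ∀ᶠ n : ℕ in l, a n = n * p n * Real.log n / (Real.exp (n * p n) - 1))
    (ha0 : ∀ᶠ n : ℕ in l, 0 < a n ∧ a n ≤ Real.log n)
    (hc : c =o[l] fun n : ℕ => Real.log n)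
    (heq : ∀ᶠ n : ℕ in l,
      (m n : ℝ) * sharedProb n (p n) = Real.log n + Real.log (a n) + c n) :
    Tendsto (fun n : ℕ => (1 + n * ((m n : ℝ) * pairProb n (p n))) / a n) l (𝓝 1) := by
  have hLlim := tendsto_log_natCast_atTop.mono_left hl
  have hLLlim := tendsto_log_log_natCast_atTop.mono_left hl
  have hL := hLlim.eventually_gt_atTop 0
  have hLL := hLLlim.eventually_gt_atTop 0
  have hn2 : ∀ᶠ n in l, 2 ≤ n := hl (eventually_ge_atTop 2)
  have hLLo : (fun n : ℕ => Real.log (Real.log n)) =o[l] fun n : ℕ => Real.log n :=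
    isLittleO_log_log_natCast.mono hl
  set η := ε / 2 / (1 + ε) with hη
  have hη0 : 0 < η := by positivity
  have hx : ∀ᶠ n : ℕ in l, n * p n ≤ 1 + (1 - η) * Real.log (Real.log n) := by
    filter_upwards [hL, hLL, hn2, hp, hm0, hm, heq, ha0, hc.bound (by positivity : 0 < ε / 4),
      hLLo.bound (by positivity : 0 < ε / 4)] with n hL hLL hn2 hp hm0 hm heq ha0 hc hLLo
    rw [Real.norm_eq_abs, Real.norm_eq_abs, abs_of_pos hL] at hc hLLo
    have hn0 : (0 : ℝ) < n := by exact_mod_cast (by omega : 0 < n)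
    have hn1 : (1 : ℝ) ≤ n := by exact_mod_cast (by omega : 1 ≤ n)
    have hm0' : (0 : ℝ) < m n := by exact_mod_cast hm0
    have hla : Real.log (a n) ≤ Real.log (Real.log n) := Real.log_le_log ha0.1 ha0.2
    have hmq : (m n : ℝ) * sharedProb n (p n) ≤ (1 + ε / 2) * Real.log n := by
      linarith [(abs_le.1 hc).2, (abs_le.1 hLLo).2]
    have hq0 : 0 ≤ sharedProb n (p n) := mul_nonneg hp.1.le
      (sub_nonneg.2 (pow_le_one₀ (by linarith) (by linarith)))
    have h1 : (n : ℝ) * sharedProb n (p n) ≤ (1 - η) * Real.log (Real.log n) := by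
      have h2 := (mul_le_mul_of_nonneg_right hm.le hq0).trans hmq
      rw [show (1 + ε) * (n * Real.log n / Real.log (Real.log n)) * sharedProb n (p n)
        = (1 + ε) * (n * sharedProb n (p n)) * Real.log n / Real.log (Real.log n) by ring,
        div_le_iff₀ hLL] at h2
      have h3 : (1 + ε) * (1 - η) = 1 + ε / 2 := by rw [hη]; field_simp; ring
      have h4 : (1 + ε) * Real.log n * (n * sharedProb n (p n))
          ≤ (1 + ε) * Real.log n * ((1 - η) * Real.log (Real.log n)) := by
        calc _ = (1 + ε) * (n * sharedProb n (p n)) * Real.log n := by ring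
          _ ≤ _ := h2
          _ = _ := by rw [← h3]; ring
      exact le_of_mul_le_mul_left h4 (by positivity)
    have h2 := mul_le_sharedProb_mul (by omega : 1 ≤ n) hp.1.le hp.2.le
    set y := (n - 1 : ℝ) * p n with hy
    have hy0 : 0 ≤ y := mul_nonneg (by linarith) hp.1.le
    have hxy : (n : ℝ) * p n = y + p n := by rw [hy]; ring
    have h3 : (n * p n - 1) * (1 + y) ≤ n * sharedProb n (p n) * (1 + y) := by
      have h4 := mul_le_mul_of_nonneg_left h2 hn0.le
      have h5 : (n * p n - 1) * (1 + y) ≤ n * p n * y := by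
        rw [hxy]; linarith [hp.2]
      linarith
    linarith [le_of_mul_le_mul_right h3 (by linarith : 0 < 1 + y)]
  have hinv : Tendsto (fun n => 1 / a n) l (𝓝 0) := by
    have hlim : Tendsto (fun n : ℕ => Real.exp 1 * Real.exp (-(η * Real.log (Real.log n)))) l
        (𝓝 0) := by
      simpa using (Real.tendsto_exp_neg_atTop_nhds_zero.comp
        (hLLlim.const_mul_atTop hη0)).const_mul (Real.exp 1)
    refine squeeze_zero' ?_ ?_ hlim
    · filter_upwards [ha0] with n ha0
      exact (one_div_pos.2 ha0.1).le
    filter_upwards [hL, hn2, hp, ha, hx] with n hL hn2 hp ha hx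
    have hx0 : 0 < (n : ℝ) * p n := mul_pos (by exact_mod_cast (by omega : 0 < n)) hp.1
    rw [ha]
    generalize (n : ℝ) * p n = x at *
    have h1 : Real.exp x - 1 ≤ x * Real.exp x := by
      have h3 := mul_le_mul_of_nonneg_right (Real.add_one_le_exp (-x)) (Real.exp_pos x).le
      rw [← Real.exp_add, neg_add_cancel, Real.exp_zero] at h3
      linarith
    have h2 : Real.exp x ≤ Real.exp 1 * Real.exp (-(η * Real.log (Real.log n))) * Real.log n := by
      conv_rhs => rw [← Real.exp_log hL, ← Real.exp_add, ← Real.exp_add, Real.log_exp]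
      rw [Real.exp_le_exp]
      linarith
    rw [one_div_div, div_le_iff₀ (by positivity)]
    calc Real.exp x - 1 ≤ x * Real.exp x := h1
      _ ≤ x * _ := mul_le_mul_of_nonneg_left h2 hx0.le
      _ = _ := by ring
  have ha1 : ∀ᶠ n in l, 1 ≤ a n := by
    filter_upwards [hinv.eventually (gt_mem_nhds one_pos), ha0] with n h ha0
    rw [div_lt_one ha0.1] at h
    exact h.le
  have hmq : Tendsto (fun n : ℕ => (m n : ℝ) * sharedProb n (p n) / Real.log n) l (𝓝 1) := by
    have h1 : Tendsto (fun n : ℕ => Real.log (a n) / Real.log n) l (𝓝 0) := by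
      refine squeeze_zero' ?_ ?_ hLLo.tendsto_div_nhds_zero
      · filter_upwards [ha1, hL] with n h hL
        exact div_nonneg (Real.log_nonneg h) hL.le
      · filter_upwards [ha0, hL] with n h hL
        exact div_le_div_of_nonneg_right (Real.log_le_log h.1 h.2) hL.le
    have h2 := (h1.const_add 1).add hc.tendsto_div_nhds_zero
    rw [add_zero, add_zero] at h2
    refine h2.congr' ?_
    filter_upwards [heq, hL] with n heq hL
    rw [heq]
    field_simp
  have hnp : Tendsto (fun n : ℕ => (n : ℝ) * p n ^ 2) l (𝓝 0) := by
    have hlim := (tendsto_log_sq_div_natCast.mono_left hl).const_mul 4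
    rw [mul_zero] at hlim
    refine squeeze_zero' (Eventually.of_forall fun n => by positivity) ?_ hlim
    filter_upwards [hLlim.eventually_ge_atTop 1, hLL, hn2, hp, hx] with n hL hLL hn2 hp hx
    have hn0 : (0 : ℝ) < n := by exact_mod_cast (by omega : 0 < n)
    have hLL' : Real.log (Real.log n) ≤ Real.log n := Real.log_le_self (by linarith)
    have h1 : (n : ℝ) * p n ≤ 2 * Real.log n := by nlinarith
    have h2 : ((n : ℝ) * p n) ^ 2 ≤ (2 * Real.log n) ^ 2 :=
      pow_le_pow_left₀ (mul_nonneg hn0.le hp.1.le) h1 2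
    rw [show (n : ℝ) * p n ^ 2 = (n * p n) ^ 2 / n by field_simp,
      show 4 * (Real.log n ^ 2 / n) = (2 * Real.log n) ^ 2 / n by ring]
    exact div_le_div_of_nonneg_right h2 hn0.le
  have hninv : Tendsto (fun n : ℕ => 1 / (n : ℝ)) l (𝓝 0) :=
    tendsto_one_div_atTop_nhds_zero_nat.mono_left hl
  have hp0 : Tendsto p l (𝓝 0) := by
    have hlim := hnp.add hninv
    rw [add_zero] at hlim
    refine squeeze_zero' (hp.mono fun n h => h.1.le) ?_ hlim
    filter_upwards [hn2] with n hn2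
    have hn0 : (0 : ℝ) < n := by exact_mod_cast (by omega : 0 < n)
    have e : (n : ℝ) * p n ^ 2 + 1 / n - p n = ((n * p n - 1 / 2) ^ 2 + 3 / 4) / n := by
      field_simp
      ring
    have : 0 ≤ ((n * p n - 1 / 2) ^ 2 + 3 / 4) / n := by positivity
    linarith
  have hp2 : ∀ᶠ n in l, p n ≤ 1 / 2 := hp0.eventually (ge_mem_nhds (by norm_num))
  have hθ : Tendsto (fun n : ℕ => (1 - p n) ^ (n - 1) * Real.exp (n * p n)) l (𝓝 1) := by
    rw [tendsto_iff_norm_sub_tendsto_zero]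
    have hlim := (hp0.const_mul 2).add hnp
    rw [mul_zero, add_zero] at hlim
    refine squeeze_zero' (Eventually.of_forall fun n => norm_nonneg _) ?_ hlim
    filter_upwards [hn2, hp, hp2] with n hn2 hp hp2
    exact abs_one_sub_pow_mul_exp_sub_one_le (by omega) hp.1.le hp2
  have hratio : Tendsto (fun n : ℕ => (Real.exp (n * p n) - (1 - p n) ^ (n - 1) * Real.exp (n * p n))
      / (Real.exp (n * p n) - 1)) l (𝓝 1) := by
    rw [tendsto_iff_norm_sub_tendsto_zero]
    have hlim := (hninv.const_mul 2).add hp0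
    rw [mul_zero, add_zero] at hlim
    refine squeeze_zero' (Eventually.of_forall fun n => norm_nonneg _) ?_ hlim
    filter_upwards [hn2, hp, hp2] with n hn2 hp hp2
    have hn0 : (0 : ℝ) < n := by exact_mod_cast (by omega : 0 < n)
    have hx0 : 0 < (n : ℝ) * p n := mul_pos hn0 hp.1
    have hθ := abs_one_sub_pow_mul_exp_sub_one_le (by omega : 1 ≤ n) hp.1.le hp2
    have hex : n * p n ≤ Real.exp (n * p n) - 1 := by linarith [Real.add_one_le_exp ((n : ℝ) * p n)]
    have hex0 : 0 < Real.exp (n * p n) - 1 := hx0.trans_le hex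
    rw [div_sub_one hex0.ne', Real.norm_eq_abs, abs_div, abs_of_pos hex0,
      show Real.exp (n * p n) - (1 - p n) ^ (n - 1) * Real.exp (n * p n) - (Real.exp (n * p n) - 1)
        = -((1 - p n) ^ (n - 1) * Real.exp (n * p n) - 1) by ring, abs_neg]
    have hpn := hp.1
    refine (div_le_div₀ (by positivity) hθ hx0 hex).trans (le_of_eq ?_)
    field_simp
  have hlim := hinv.add ((hmq.mul (hθ.div (hp0.const_sub 1) (by norm_num))).div hratio one_ne_zero)
  norm_num at hlim
  refine hlim.congr' ?_
  filter_upwards [hn2, hp, ha, hL] with n hn2 hp ha hL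
  have hn0 : (0 : ℝ) < n := by exact_mod_cast (by omega : 0 < n)
  have hx0 : 0 < (n : ℝ) * p n := mul_pos hn0 hp.1
  have hex0 : 0 < Real.exp (n * p n) - 1 := by linarith [Real.add_one_le_exp ((n : ℝ) * p n)]
  have hr : 0 < 1 - (1 - p n) ^ (n - 1) :=
    sub_pos.2 (pow_lt_one₀ (by linarith) (by linarith) (by omega))
  have h1p : 0 < 1 - p n := by linarith
  have hsplit : (1 - p n) ^ (n - 1) = (1 - p n) ^ (n - 2) * (1 - p n) := by
    rw [← pow_succ]; congr 1; omega
  have hexpne := Real.exp_ne_zero (n * p n)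
  have hfac : Real.exp (n * p n) - (1 - p n) ^ (n - 1) * Real.exp (n * p n)
      = Real.exp (n * p n) * (1 - (1 - p n) ^ (n - 1)) := by ring
  have hpne := hp.1.ne'
  have h1 : m n * sharedProb n (p n) / Real.log n
      * ((1 - p n) ^ (n - 1) * Real.exp (n * p n) / (1 - p n))
      / ((Real.exp (n * p n) - (1 - p n) ^ (n - 1) * Real.exp (n * p n)) / (Real.exp (n * p n) - 1))
      = n * (m n * pairProb n (p n)) / a n := by
    have h2 : (1 - p n) ^ (n - 1) * Real.exp (n * p n) / (1 - p n)
        = (1 - p n) ^ (n - 2) * Real.exp (n * p n) := by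
      rw [hsplit]; field_simp
    rw [h2, hfac, ha, pairProb, sharedProb]
    generalize 1 - (1 - p n) ^ (n - 1) = r at *
    generalize Real.exp (n * p n) = E at *
    field_simp
  rw [add_div, ← h1]
  simp

lemma pendantRatio_pos_and_le {x L : ℝ} (hx : 0 < x) (hL : 0 < L) :
    0 < x * L / (Real.exp x - 1) ∧ x * L / (Real.exp x - 1) ≤ L := by
  have h1 : x ≤ Real.exp x - 1 := by linarith [Real.add_one_le_exp x]
  have h2 : 0 < Real.exp x - 1 := hx.trans_le h1
  refine ⟨by positivity, ?_⟩
  rw [div_le_iff₀ h2, mul_comm]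
  exact mul_le_mul_of_nonneg_left h1 hL.le

theorem theorem2 (m : ℕ → ℕ) (p : ℕ → unitInterval) (a c : ℕ → ℝ) (ε : ℝ) (hε : 0 < ε)
    (hp : ∀ᶠ n in atTop, 0 < (p n : ℝ) ∧ (p n : ℝ) < 1)
    (hm : (fun n : ℕ => Real.log n ^ 2) =o[atTop] fun n : ℕ => (m n : ℝ))
    (ha : ∀ᶠ n : ℕ in atTop,
      ((m n : ℝ) < (1 - ε) * (n * Real.log n / Real.log (Real.log n)) ∧ a n = 1) ∨
      ((m n : ℝ) > (1 + ε) * (n * Real.log n / Real.log (Real.log n)) ∧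
        a n = n * (p n : ℝ) * Real.log n / (Real.exp (n * (p n : ℝ)) - 1)))
    (hc : c =o[atTop] fun n : ℕ => Real.log n)
    (heq : ∀ᶠ n : ℕ in atTop,
      (p n : ℝ) * (1 - (1 - (p n : ℝ)) ^ (n - 1)) =
        (Real.log n + Real.log (a n) + c n) / (m n : ℝ)) :
    (Tendsto c atTop atBot →
      Tendsto (fun n => probMinDegreeGeTwo n (m n) (p n)) atTop (𝓝 0)) ∧
    (∀ c₀ : ℝ, Tendsto c atTop (𝓝 c₀) →
      Tendsto (fun n => probMinDegreeGeTwo n (m n) (p n)) atTop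
        (𝓝 (Real.exp (-Real.exp (-c₀))))) ∧
    (Tendsto c atTop atTop →
      Tendsto (fun n => probMinDegreeGeTwo n (m n) (p n)) atTop (𝓝 1)) := by
  have hL := tendsto_log_natCast_atTop.eventually_ge_atTop 1
  have hm0 : ∀ᶠ n in atTop, 0 < m n := by
    filter_upwards [hm.bound one_pos, hL] with n h hL
    rw [Real.norm_eq_abs, Real.norm_eq_abs, abs_of_nonneg (by positivity : (0 : ℝ) ≤ m n),
      abs_of_nonneg (sq_nonneg _), one_mul] at h
    have h1 : (0 : ℝ) < m n := lt_of_lt_of_le (by positivity) h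
    exact_mod_cast h1
  have hmq : ∀ᶠ n : ℕ in atTop, (m n : ℝ) * sharedProb n (p n)
      = Real.log n + Real.log (a n) + c n := by
    filter_upwards [heq, hm0] with n heq hm0
    have : (m n : ℝ) ≠ 0 := by positivity
    rw [sharedProb, heq, mul_div_cancel₀ _ this]
  have ha0 : ∀ᶠ n : ℕ in atTop, 0 < a n ∧ a n ≤ Real.log n := by
    filter_upwards [ha, hL, hp, eventually_gt_atTop 0] with n ha hL hp hn
    rcases ha with ⟨-, h⟩ | ⟨-, h⟩
    · rw [h]; exact ⟨one_pos, hL⟩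
    · rw [h]
      exact pendantRatio_pos_and_le (mul_pos (by exact_mod_cast hn) hp.1) (by linarith)
  have hmp : Tendsto (fun n => (m n : ℝ) * (p n : ℝ) ^ 2) atTop (𝓝 0) := by
    have h1 : Tendsto (fun n : ℕ => Real.log n / ((n : ℝ) - 1)) atTop (𝓝 0) := by
      have h2 : Tendsto (fun n : ℕ => 2 * (Real.log n ^ 2 / n)) atTop (𝓝 0) := by
        simpa using tendsto_log_sq_div_natCast.const_mul 2
      refine squeeze_zero' ?_ ?_ h2
      · filter_upwards [hL, eventually_ge_atTop 2] with n hL hn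
        have : (2 : ℝ) ≤ n := by exact_mod_cast hn
        exact div_nonneg (by linarith) (by linarith)
      · filter_upwards [hL, eventually_ge_atTop 2] with n hL hn
        have hn' : (2 : ℝ) ≤ n := by exact_mod_cast hn
        rw [← mul_div_assoc, div_le_div_iff₀ (by linarith) (by linarith)]
        have h3 : Real.log n ≤ Real.log n ^ 2 := by nlinarith
        nlinarith
    have h2 := (h1.const_mul 4).add (hm.tendsto_div_nhds_zero.const_mul 4)
    rw [mul_zero, add_zero] at h2
    refine squeeze_zero' (Eventually.of_forall fun n => by positivity) ?_ h2
    filter_upwards [hL, hp, hm0, hmq, ha0, eventually_ge_atTop 2,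
      hc.bound (by norm_num : (0 : ℝ) < 1 / 2),
      isLittleO_log_log_natCast.bound (by norm_num : (0 : ℝ) < 1 / 2)] with
      n hL hp hm0 hmq ha0 hn hc hLL
    rw [Real.norm_eq_abs, Real.norm_eq_abs, abs_of_nonneg (by linarith : 0 ≤ Real.log n)] at hc hLL
    have hla := Real.log_le_log ha0.1 ha0.2
    rw [← mul_div_assoc]
    exact mul_sq_le_of_mul_sharedProb_le hn (by exact_mod_cast hm0) hp.1.le hp.2.le
      (by linarith [(abs_le.1 hc).2, (abs_le.1 hLL).2])
  have hp0 : Tendsto (fun n => (p n : ℝ)) atTop (𝓝 0) := by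
    have hsqrt : Tendsto (fun n => Real.sqrt ((m n : ℝ) * (p n : ℝ) ^ 2)) atTop (𝓝 0) := by
      have h := (Real.continuous_sqrt.tendsto 0).comp hmp
      rwa [Real.sqrt_zero] at h
    refine squeeze_zero' (Eventually.of_forall fun n => (p n).2.1) ?_ hsqrt
    filter_upwards [hm0] with n hm0
    refine Real.le_sqrt_of_sq_le (le_mul_of_one_le_left (sq_nonneg _) ?_)
    exact_mod_cast hm0
  have hratio : Tendsto (fun n : ℕ => (1 + n * ((m n : ℝ) * pairProb n (p n))) / a n) atTop
      (𝓝 1) := by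
    let R₁ : Set ℕ := {n | (m n : ℝ) < (1 - ε) * (n * Real.log n / Real.log (Real.log n)) ∧ a n = 1}
    let R₂ : Set ℕ := {n | (m n : ℝ) > (1 + ε) * (n * Real.log n / Real.log (Real.log n)) ∧
        a n = n * (p n : ℝ) * Real.log n / (Real.exp (n * (p n : ℝ)) - 1)}
    have hle : (atTop : Filter ℕ) ≤ (atTop ⊓ 𝓟 R₁) ⊔ (atTop ⊓ 𝓟 R₂) := by
      rw [← inf_sup_left, sup_principal]
      exact le_inf le_rfl (le_principal_iff.2 ha)
    refine Tendsto.mono_left (Tendsto.sup ?_ ?_) hle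
    · have hl : atTop ⊓ 𝓟 R₁ ≤ atTop := inf_le_left
      have hR : ∀ᶠ n in atTop ⊓ 𝓟 R₁, n ∈ R₁ := mem_inf_of_right (mem_principal_self R₁)
      have h := tendsto_mul_pairProb_of_few_features hl hε (hl hp) (hl hm0)
        (hR.mono fun n h => h.1) (hc.mono hl) (by
          filter_upwards [hR, hl hmq] with n hR hmq
          rw [hmq, hR.2, Real.log_one, add_zero])
      have h1 := h.const_add 1
      rw [add_zero] at h1
      refine h1.congr' ?_
      filter_upwards [hR] with n hR
      rw [hR.2, div_one]
    · have hl : atTop ⊓ 𝓟 R₂ ≤ atTop := inf_le_left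
      have hR : ∀ᶠ n in atTop ⊓ 𝓟 R₂, n ∈ R₂ := mem_inf_of_right (mem_principal_self R₂)
      exact tendsto_one_add_mul_pairProb_div_of_many_features hl hε (hl hp) (hl hm0)
        (hR.mono fun n h => h.1) (hR.mono fun n h => h.2) (hl ha0) (hc.mono hl) (hl hmq)
  have hmean : (fun n : ℕ => Real.exp (-c n) * ((1 + n * ((m n : ℝ) * pairProb n (p n))) / a n))
      =ᶠ[atTop] fun n => smallDegreeMean n (m n) (p n) := by
    filter_upwards [hmq, ha0, eventually_gt_atTop 0] with n hmq ha0 hn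
    have hn0 : (0 : ℝ) < n := by exact_mod_cast hn
    have ha' := ha0.1
    rw [smallDegreeMean, hmq, neg_add, neg_add, Real.exp_add, Real.exp_add, Real.exp_neg (c n),
      Real.exp_neg (Real.log n), Real.exp_neg (Real.log (a n)), Real.exp_log hn0, Real.exp_log ha']
    field_simp
  obtain ⟨hfin, hinf⟩ := tendsto_probMinDegreeGeTwo_of_smallDegreeMean hp0 hmp
  refine ⟨fun h => hinf ?_, fun c₀ h => hfin _ ?_, fun h => ?_⟩
  · exact Tendsto.congr' hmean (((Real.tendsto_exp_atTop.comp
      (tendsto_neg_atBot_atTop.comp h))).atTop_mul_pos one_pos hratio)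
  · have h1 := ((Real.continuous_exp.tendsto _).comp h.neg).mul hratio
    rw [mul_one] at h1
    exact h1.congr' hmean
  · have h1 := (Real.tendsto_exp_neg_atTop_nhds_zero.comp h).mul hratio
    rw [zero_mul] at h1
    have h2 := hfin 0 (h1.congr' hmean)
    rwa [neg_zero, Real.exp_zero] at h2
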